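/- **Setting.** Let $d\in\{1,2,3\}$, let $\Omega\subset\mathbb R^d$ be open and bounded, or $d=1$ and $\Omega=[0,L]$ with $L>0$, and let $0<n_-<n_+<\infty$. Let $\mathcal A$ be the set of measurable $n:\mathbb R^d\to\mathbb R$ with $n_-\le n\le n_+$ a.e. on $\overline\Omega$ and $n=1$ a.e. off $\overline\Omega$. The outgoing Green's function is $$G(r,\omega)=-\frac{e^{i\omega r}}{2i\omega}\ (d=1),\qquad G(r,\omega)=-\frac{1}{4i}H^{(1)}_0(\omega r)\ (d=2),\qquad G(r,\omega)=\frac{e^{i\omega r}}{4\pi r}\ (d=3),$$ where for $d=2$ any determination of $H_0^{(1)}$ (that is, of $\log\omega$) that is holomorphic near the frequency considered may be used. Put $$(T_{\omega}^{n}u)(x)=\omega^2\int_\Omega G(|x-y|,\omega)\,(n(y)^2-1)\,u(y)\,dy .$$ A *scattering resonance pair* of $n$ is a pair $(\omega,u)$ with $\omega\in\mathbb C$ and $u\in L^1_{\rm loc}(\mathbb R^d)$, $u\neq0$, such that $u=T_\omega^n u$; $u$ is identified with its continuous representative, so that the equation holds at every point. $\mathrm{Res}_n$ is the set of such $\omega$.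 The pair is *nondegenerate* if $\omega$ is an algebraically simple eigenvalue of $z\mapsto \mathrm{Id}-T_z^n$: every solution $v\in L^1_{\rm loc}$ of $v=T_\omega^nv$ is a multiple of $u$, and no $w\in L^1_{\rm loc}$ satisfies $w-T_\omega^n w=\partial_z(T_z^nu)|_{z=\omega}$. **Proposition.** Let $n\in\mathcal A$ and let $(\omega,u)$ be a nondegenerate scattering resonance pair of $n$. Then there are $\varepsilon,\delta>0$ such that every $n'\in\mathcal A$ with $\|n'-n\|_{L^\infty(\Omega)}<\delta$ has exactly one resonance $\omega[n']$ with $|\omega[n']-\omega|<\varepsilon$ (and $\omega[n]=\omega$), and the following hold. 1. There is $\alpha\in\mathbb C\setminus\{0\}$ (depending on $u$) such that $\omega[\cdot]$ has at $n$ the first variation $$\frac{\delta\omega}{\delta n}(x)=-2\,\overline\alpha\,\overline\omega^{2}\,n(x)\,\overline{u(x)}^{2}\in L^1(\Omega),$$ that is, for $n+\delta n\in\mathcal A$, as $\|\delta n\|_{L^\infty(\Omega)}\to0$, $$\omega[n+\delta n]-\omega[n]-\int_\Omega\overline{\frac{\delta\omega}{\delta n}(x)}\;\delta n(x)\,dx=o\bigl(\|\delta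 n\|_{L^\infty(\Omega)}\bigr).$$ 2. If $d=1$ and $\Omega=[0,L]$, then $u$ is $C^1$, and part 1 holds with the $\alpha\ne0$ given by $$\alpha^{-1}=2\omega\int_0^L n^2u^2\,dx+i\,[u(0)^2+u(L)^2]=\frac1\omega\int_0^L\bigl(u_x^2+\omega^2n^2u^2\bigr)\,dx .$$ -/

import Mathlib

open MeasureTheory Filter Topology
open scoped Nat ENNReal ComplexConjugate

noncomputable section

namespace ScatteringResonance

/-! ### The outgoing free-space Green's functions -/

/-- The Bessel function `J₀`, by its (everywhere convergent) power series. -/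
def besselJ0 (z : ℂ) : ℂ :=
  ∑' k : ℕ, (-1 : ℂ) ^ k / ((k ! : ℂ)) ^ 2 * (z / 2) ^ (2 * k)

/-- The Bessel function `Y₀` at `z`, by its classical expansion
`Y₀(z) = (2/π) ((log (z/2) + γ) J₀(z) + ∑ₖ (-1)^(k+1) Hₖ (z/2)^(2k) / (k!)²)`, where `Hₖ` is the
`k`-th harmonic number and `γ` is Euler's constant. The argument `lz` is the value of `log z` that
is used: `Y₀` is multivalued, and its determinations are those of the logarithm. -/
def besselY0 (z lz : ℂ) : ℂ :=
  2 / (Real.pi : ℂ) *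
    ((lz - (Real.log 2 : ℂ) + (Real.eulerMascheroniConstant : ℂ)) * besselJ0 z +
      ∑' k : ℕ, (-1 : ℂ) ^ (k + 1) * ((harmonic k : ℚ) : ℂ) / ((k ! : ℂ)) ^ 2 *
        (z / 2) ^ (2 * k))

/-- The Hankel function `H₀⁽¹⁾ = J₀ + i Y₀`, where `lz` is the value of `log z` that is used. -/
def hankelH0 (z lz : ℂ) : ℂ := besselJ0 z + Complex.I * besselY0 z lz

/-- The outgoing Green's function for `d = 1`, at distance `r` and frequency `z`. -/
def green1 (r : ℝ) (z : ℂ) : ℂ := -(2 * Complex.I * z)⁻¹ * Complex.exp (Complex.I * z * r)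

/-- The outgoing Green's function for `d = 2`, `-(4i)⁻¹ H₀⁽¹⁾(z r)`; here `lg` is the determination
of the logarithm of the frequency, and `log (z r) = lg z + log r` for `r > 0`. -/
def green2 (lg : ℂ → ℂ) (r : ℝ) (z : ℂ) : ℂ :=
  -(4 * Complex.I)⁻¹ * hankelH0 (z * r) (lg z + (Real.log r : ℂ))

/-- The outgoing Green's function for `d = 3`. -/
def green3 (r : ℝ) (z : ℂ) : ℂ :=
  (4 * (Real.pi : ℂ) * (r : ℂ))⁻¹ * Complex.exp (Complex.I * z * r)

/-- The outgoing Green's function in dimension `d = 1, 2, 3` (the value `0` for other `d` is never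
used). The determination `lg` of the logarithm matters only for `d = 2`. -/
def outgoingGreen (lg : ℂ → ℂ) (d : ℕ) : ℝ → ℂ → ℂ :=
  match d with
  | 1 => green1
  | 2 => green2 lg
  | 3 => green3
  | _ => fun _ _ => 0

/-- `lg` is, near `ω`, a holomorphic determination of the logarithm. -/
def IsLogDeterminationAt (lg : ℂ → ℂ) (ω : ℂ) : Prop :=
  AnalyticAt ℂ lg ω ∧ ∀ᶠ z in 𝓝 ω, Complex.exp (lg z) = z

/-! ### Admissible indices, scattering resonances -/

section Defs

variable {E : Type*} [NormedAddCommGroup E] [MeasureSpace E]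

/-- The admissible class `𝒜(Ω, n₋, n₊)`: measurable indices with `n₋ ≤ n ≤ n₊` on the closure of
`Ω` and `n = 1` off the closure of `Ω` (up to null sets, `𝒜` being a subset of `L^∞`). -/
def Admissible (Ω : Set E) (nm np : ℝ) : Set (E → ℝ) :=
  {n | AEMeasurable n volume ∧ (∀ᵐ x, x ∈ closure Ω → nm ≤ n x ∧ n x ≤ np) ∧
    ∀ᵐ x, x ∉ closure Ω → n x = 1}

/-- `z² ∫_Ω G(|x - y|, z) (n(y)² - 1) u(y) dy`, the right-hand side of the scattering resonance
problem at frequency `z`. -/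
def scatteringOp (G : ℝ → ℂ → ℂ) (Ω : Set E) (n : E → ℝ) (z : ℂ) (u : E → ℂ) (x : E) : ℂ :=
  z ^ 2 * ∫ y in Ω, G ‖x - y‖ z * ((n y : ℂ) ^ 2 - 1) * u y

/-- `(ω, u)` is a scattering resonance pair: `u` is a nontrivial locally integrable solution of the
scattering resonance problem. (The equation, imposed at every point, selects the continuous
representative of the mode.) -/
def IsResonancePair (G : ℝ → ℂ → ℂ) (Ω : Set E) (n : E → ℝ) (ω : ℂ) (u : E → ℂ) : Prop :=
  LocallyIntegrable u volume ∧ u ≠ 0 ∧ ∀ x, u x = scatteringOp G Ω n ω u x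

/-- The set `Res_n` of scattering resonances. -/
def Res (G : ℝ → ℂ → ℂ) (Ω : Set E) (n : E → ℝ) : Set ℂ :=
  {ω | ∃ u, IsResonancePair G Ω n ω u}

/-- The resonance pair `(ω, u)` is nondegenerate, that is, `ω` is a simple eigenvalue (of algebraic
multiplicity one) of the holomorphic family `A(z) = Id - z² R_z`, where `z² R_z` is `scatteringOp`:
every mode at `ω` is a multiple of `u`, and `u` has no generalized (associated) mode, i.e. no `w`
with `A(ω) w + A'(ω) u = 0`. -/
def IsNondegenerate (G : ℝ → ℂ → ℂ) (Ω : Set E) (n : E → ℝ) (ω : ℂ) (u : E → ℂ) : Prop :=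
  (∀ v, IsResonancePair G Ω n ω v → ∃ c : ℂ, v = c • u) ∧
  ¬ ∃ w : E → ℂ, LocallyIntegrable w volume ∧
    ∀ x, w x - scatteringOp G Ω n ω w x = deriv (fun z => scatteringOp G Ω n z u x) ω

/-- The norm of `L^∞(Ω)`, with values in `[0, ∞]`. -/
def supNorm (Ω : Set E) (h : E → ℝ) : ℝ≥0∞ := eLpNorm h ∞ (volume.restrict Ω)

/-- `W` is, near the index `n`, the map `n' ↦ ω[n']` that continues the resonance `ω` of `n`:
`W n = ω`, and for admissible `n'` near `n` in `L^∞`, `W n'` is the one and only resonance of `n'`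
in a fixed disc about `ω`. This determines `W` near `n`. -/
def IsResonanceMapAt (G : ℝ → ℂ → ℂ) (Ω : Set E) (nm np : ℝ) (n : E → ℝ) (ω : ℂ)
    (W : (E → ℝ) → ℂ) : Prop :=
  W n = ω ∧ ∃ ε : ℝ, 0 < ε ∧ ∃ δ : ℝ, 0 < δ ∧
    ∀ n' ∈ Admissible Ω nm np, supNorm Ω (n' - n) < ENNReal.ofReal δ →
      W n' ∈ Metric.ball ω ε ∧ Res G Ω n' ∩ Metric.ball ω ε = {W n'}

/-- `J` is Fréchet differentiable at `n` along the admissible class, with first variation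
`δJ/δn = g ∈ L¹(Ω)`: for admissible `n' = n + δn`,
`J[n + δn] - J[n] - ∫_Ω conj(g) δn = o(‖δn‖_{L^∞(Ω)})`. -/
def HasFirstVariationAt (Ω : Set E) (nm np : ℝ) (J : (E → ℝ) → ℂ) (n : E → ℝ) (g : E → ℂ) :
    Prop :=
  IntegrableOn g Ω volume ∧
  ∀ ε : ℝ, 0 < ε → ∃ δ : ℝ, 0 < δ ∧
    ∀ n' ∈ Admissible Ω nm np, supNorm Ω (n' - n) < ENNReal.ofReal δ →
      ‖J n' - J n - ∫ x in Ω, conj (g x) * ((n' x - n x : ℝ) : ℂ)‖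
        ≤ ε * (supNorm Ω (n' - n)).toReal

/-- The function `-2 ᾱ ω̄² n ū²`. -/
def gradOmega (α ω : ℂ) (n : E → ℝ) (u : E → ℂ) (x : E) : ℂ :=
  -2 * conj α * conj ω ^ 2 * (n x : ℂ) * conj (u x) ^ 2

end Defs

end ScatteringResonance

end

/-!
On `L¹(Ω)` the resonance problem is the fixed point equation `T u = u` of a compact operator
`T = T (V, z)`, linear in the contrast `V = n² - 1` and holomorphic in the frequency `z`. Near a
simple fixed vector `u`, bordering `1 - T` by the rank one operator `∂_z T u ⊗ l`, with `l u = 1`,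
gives an invertible operator, and the resonances are the solutions `z` of one scalar equation
`F (V, z) = 1`. The implicit function theorem yields the branch `z = W V`, with derivative
`-ψ (∂_V T u)`, where `ψ` is the functional that vanishes on the range of `1 - T` and is normalized
by `ψ (∂_z T u) = 1`. As the Green's function is even, `ψ` is a multiple of `a ↦ ∫_Ω (n² - 1) u a`,
and `ψ (∂_V T u [δV]) = α ω² ∫_Ω u² δV` with `α⁻¹ = ω² ∫_Ω (n² - 1) u ∂_z T u`.

On an interval, `u` and `∂_z T u` solve Helmholtz equations with outgoing boundary conditions;
Lagrange's identity for the two evaluates `α⁻¹`, and the energy identity for `u` turns the result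
into its second form.
-/

namespace ScatteringResonance

section SimpleEigenvalues

variable {𝕜 X : Type*} [RCLike 𝕜] [NormedAddCommGroup X] [NormedSpace 𝕜 X]

/-- `u` spans the fixed space of `T`, and `f` is not in the range of `1 - T`. When `T` is the value
at `ω` of a holomorphic family of compact operators and `f` is `u` acted on by the derivative of the
family, this says that `1` is an algebraically simple eigenvalue at the parameter `ω`. -/
structure IsSimpleFixedVector (T : X →L[𝕜] X) (u f : X) : Prop where
  ne_zero : u ≠ 0
  apply_eq : T u = u
  exists_eq_smul : ∀ v, T v = v → ∃ c : 𝕜, v = c • u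
  sub_apply_ne : ∀ w, w - T w ≠ f

/-- The operator `1 - T` bordered by the rank one operator `f ⊗ l`. -/
noncomputable def bordered (T : X →L[𝕜] X) (l : X →L[𝕜] 𝕜) (f : X) : X →L[𝕜] X :=
  1 - T + l.smulRight f

/-- The scalar `l ((1 - T + f ⊗ l)⁻¹ f)`. As long as the inverse exists, its value is `1` exactly
when `1` is an eigenvalue of `T`. -/
noncomputable def characteristic (T : X →L[𝕜] X) (l : X →L[𝕜] 𝕜) (f : X) : 𝕜 :=
  l (Ring.inverse (bordered T l f) f)

theorem bordered_apply (T : X →L[𝕜] X) (l : X →L[𝕜] 𝕜) (f v : X) :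
    bordered T l f v = v - T v + l v • f := rfl

theorem ringInverse_apply_apply {A : X →L[𝕜] X} (hA : IsUnit A) (v : X) :
    Ring.inverse A (A v) = v :=
  DFunLike.congr_fun (Ring.inverse_mul_cancel A hA) v

theorem apply_ringInverse_apply {A : X →L[𝕜] X} (hA : IsUnit A) (v : X) :
    A (Ring.inverse A v) = v :=
  DFunLike.congr_fun (Ring.mul_inverse_cancel A hA) v

theorem isCompactOperator_smulRight {Y : Type*} [NormedAddCommGroup Y] [NormedSpace 𝕜 Y]
    (l : X →L[𝕜] 𝕜) (f : Y) : IsCompactOperator (l.smulRight f) :=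
  (isCompactOperator_of_locallyCompactSpace_rng
    (ContinuousLinearMap.toSpanSingleton 𝕜 f)).comp_clm l

theorem IsSimpleFixedVector.isUnit_bordered [CompleteSpace X] {T : X →L[𝕜] X} {u f : X}
    (h : IsSimpleFixedVector T u f) (hT : IsCompactOperator T) {l : X →L[𝕜] 𝕜} (hl : l u = 1) :
    IsUnit (bordered T l f) := by
  have hK : IsCompactOperator ⇑(T - l.smulRight f) := hT.sub (isCompactOperator_smulRight l f)
  rcases hK.hasEigenvalue_or_mem_resolventSet (one_ne_zero (α := 𝕜)) with hev | hres
  · obtain ⟨v, hv⟩ := hev.exists_hasEigenvector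
    have hTv : T v - l v • f = v := by simpa using hv.apply_eq_smul
    have hlv : l v = 0 := by
      by_contra hne
      refine h.sub_apply_ne (-(l v)⁻¹ • v) ?_
      have hsub : v - T v = -(l v • f) := by
        rw [eq_neg_iff_add_eq_zero]
        nth_rewrite 1 [← hTv]
        abel
      rw [map_smul, ← smul_sub, hsub, smul_neg, neg_smul, neg_neg, inv_smul_smul₀ hne]
    rw [hlv, zero_smul, sub_zero] at hTv
    obtain ⟨c, rfl⟩ := h.exists_eq_smul v hTv
    have hc : c = 0 := by simpa [hl] using hlv
    exact absurd (by rw [hc, zero_smul]) hv.2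
  · convert spectrum.mem_resolventSet_iff.mp hres using 1
    rw [bordered, map_one, sub_add]

theorem exists_fixed_ne_zero_iff_characteristic {T : X →L[𝕜] X} {l : X →L[𝕜] 𝕜} {f : X}
    (hA : IsUnit (bordered T l f)) : (∃ v, v ≠ 0 ∧ T v = v) ↔ characteristic T l f = 1 := by
  set w := Ring.inverse (bordered T l f) f with hw
  constructor
  · rintro ⟨v, hv0, hv⟩
    have hvw : l v • w = v := by
      rw [hw, ← map_smul]
      simpa [bordered_apply, hv] using ringInverse_apply_apply hA v
    have hlv : l v ≠ 0 := fun h0 => hv0 (by rw [← hvw, h0, zero_smul])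
    refine mul_left_cancel₀ hlv ?_
    rw [mul_one, characteristic, ← smul_eq_mul, ← map_smul, ← hw, hvw]
  · intro h1
    have hlw : l w = 1 := h1
    have hAw : w - T w + l w • f = f := apply_ringInverse_apply hA f
    refine ⟨w, fun h0 => by simp [h0] at hlw, ?_⟩
    rw [hlw, one_smul, add_eq_right, sub_eq_zero] at hAw
    exact hAw.symm

theorem apply_eq_of_forall_sub_apply_eq_zero {T : X →L[𝕜] X} {l ψ : X →L[𝕜] 𝕜} {f : X}
    (hA : IsUnit (bordered T l f)) (hψ : ∀ w, ψ (w - T w) = 0) (x : X) :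
    ψ x = l (Ring.inverse (bordered T l f) x) * ψ f := by
  conv_lhs => rw [← apply_ringInverse_apply hA x, bordered_apply, map_add, hψ, zero_add, map_smul,
    smul_eq_mul]

theorem IsSimpleFixedVector.apply_ne_zero [CompleteSpace X] {T : X →L[𝕜] X} {u f : X}
    (h : IsSimpleFixedVector T u f) (hT : IsCompactOperator T) {ψ : X →L[𝕜] 𝕜} (hψ0 : ψ ≠ 0)
    (hψ : ∀ w, ψ (w - T w) = 0) : ψ f ≠ 0 := by
  obtain ⟨l, hl⟩ := SeparatingDual.exists_eq_one (R := 𝕜) h.ne_zero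
  refine fun hf => hψ0 (ContinuousLinearMap.ext fun x => ?_)
  rw [apply_eq_of_forall_sub_apply_eq_zero (h.isUnit_bordered hT hl) hψ, hf, mul_zero,
    zero_apply]

theorem hasStrictFDerivAt_characteristic [CompleteSpace X] {Q : Type*} [NormedAddCommGroup Q]
    [NormedSpace 𝕜 Q] {T : Q → X →L[𝕜] X} {T' : Q →L[𝕜] X →L[𝕜] X} {q₀ : Q}
    (hT : HasStrictFDerivAt T T' q₀) {l ψ : X →L[𝕜] 𝕜} {u f : X}
    (hA : IsUnit (bordered (T q₀) l f)) (hu : T q₀ u = u) (hl : l u = 1)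
    (hψ : ∀ w, ψ (w - T q₀ w) = 0) (hψf : ψ f = 1) :
    HasStrictFDerivAt (fun q => characteristic (T q) l f) (ψ ∘L T'.flip u) q₀ := by
  obtain ⟨a, ha⟩ := hA
  have ha_inv : Ring.inverse (bordered (T q₀) l f) = ↑a⁻¹ := by rw [← ha, Ring.inverse_unit]
  have hu_inv : (↑a⁻¹ : X →L[𝕜] X) f = u := by
    have := ringInverse_apply_apply ⟨a, ha⟩ u
    rwa [bordered_apply, hu, sub_self, zero_add, hl, one_smul, ha_inv] at this
  have hψ_inv (x : X) : l ((↑a⁻¹ : X →L[𝕜] X) x) = ψ x := by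
    rw [apply_eq_of_forall_sub_apply_eq_zero ⟨a, ha⟩ hψ x, hψf, mul_one, ha_inv]
  have hbordered : HasStrictFDerivAt (fun q => bordered (T q) l f) (-T') q₀ :=
    (hT.const_sub 1).add_const _
  have hinverse : HasStrictFDerivAt (Ring.inverse : (X →L[𝕜] X) → X →L[𝕜] X)
      (-ContinuousLinearMap.mulLeftRight 𝕜 (X →L[𝕜] X) ↑a⁻¹ ↑a⁻¹) (bordered (T q₀) l f) :=
    ha ▸ hasStrictFDerivAt_ringInverse a
  convert! (l ∘L ContinuousLinearMap.apply 𝕜 X f).hasStrictFDerivAt.comp q₀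
    (hinverse.comp q₀ hbordered) using 1
  ext q
  simp [hu_inv, hψ_inv]

variable {P : Type*} [NormedAddCommGroup P] [NormedSpace 𝕜 P] [CompleteSpace P] [CompleteSpace X]

theorem IsSimpleFixedVector.exists_branch {T : P × 𝕜 → X →L[𝕜] X}
    {T' : P × 𝕜 →L[𝕜] X →L[𝕜] X} {p₀ : P} {ω : 𝕜} (hT : HasStrictFDerivAt T T' (p₀, ω))
    (hTc : IsCompactOperator (T (p₀, ω))) {u : X}
    (h : IsSimpleFixedVector (T (p₀, ω)) u (T' (0, 1) u)) {ψ : X →L[𝕜] 𝕜}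
    (hψ : ∀ w, ψ (w - T (p₀, ω) w) = 0) (hψf : ψ (T' (0, 1) u) = 1) :
    ∃ W : P → 𝕜, W p₀ = ω ∧
      (∀ᶠ q in 𝓝 (p₀, ω), (∃ v, v ≠ 0 ∧ T q v = v) ↔ q.2 = W q.1) ∧
      HasFDerivAt W (-(ψ ∘L T'.flip u ∘L .inl 𝕜 P 𝕜)) p₀ := by
  obtain ⟨l, hl⟩ := SeparatingDual.exists_eq_one (R := 𝕜) h.ne_zero
  have hA := h.isUnit_bordered hTc hl
  have hF := hasStrictFDerivAt_characteristic hT hA h.apply_eq hl hψ hψf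
  have hF_inr : (ψ ∘L T'.flip u) ∘L .inr 𝕜 P 𝕜 = .id 𝕜 𝕜 := by
    ext
    simpa using hψf
  have hinv : ((ψ ∘L T'.flip u) ∘L .inr 𝕜 P 𝕜).IsInvertible := by
    rw [hF_inr]
    exact ⟨ContinuousLinearEquiv.refl 𝕜 𝕜, rfl⟩
  have hbranch := hF.eventually_apply_eq_iff_implicitFunctionOfProdDomain hinv
  refine ⟨hF.implicitFunctionOfProdDomain hinv, hbranch.self_of_nhds.mp rfl, ?_, ?_⟩
  · have hone : characteristic (T (p₀, ω)) l (T' (0, 1) u) = 1 :=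
      (exists_fixed_ne_zero_iff_characteristic hA).mp ⟨u, h.ne_zero, h.apply_eq⟩
    have hbordered : ContinuousAt (fun q => bordered (T q) l (T' (0, 1) u)) (p₀, ω) :=
      (continuousAt_const.sub hT.continuousAt).add continuousAt_const
    filter_upwards [hbranch, hbordered (Units.isOpen.mem_nhds hA)] with q hq hqA
    rw [exists_fixed_ne_zero_iff_characteristic hqA, eq_comm (a := q.2), ← hq, hone]
  · convert! (hF.hasStrictFDerivAt_implicitFunctionOfProdDomain hinv).hasFDerivAt using 1
    rw [hF_inr, ContinuousLinearMap.inverse_id]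
    ext p
    simp

end SimpleEigenvalues

section Convolution

theorem ae_norm_le_of_memLp_top {α F : Type*} [MeasurableSpace α] {μ : Measure α}
    [NormedAddCommGroup F] {f : α → F} (hf : MemLp f ∞ μ) :
    ∀ᵐ x ∂μ, ‖f x‖ ≤ (eLpNorm f ∞ μ).toReal := by
  filter_upwards [enorm_ae_le_eLpNormEssSup f μ] with x hx
  rw [eLpNorm_exponent_top, ← toReal_enorm]
  exact ENNReal.toReal_mono (eLpNorm_exponent_top (f := f) ▸ hf.eLpNorm_ne_top) hx

variable {E : Type*} [NormedAddCommGroup E] [NormedSpace ℝ E] [FiniteDimensional ℝ E]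
  [MeasureSpace E] [BorelSpace E] [(volume : Measure E).IsAddHaarMeasure]

/-- The convolution `∫_Ω k (x - y) u(y) dy` of the kernel `k` with the restriction of `u` to `Ω`. -/
noncomputable def convOn {E : Type*} [NormedAddCommGroup E] [MeasureSpace E] (Ω : Set E)
    (k u : E → ℂ) (x : E) : ℂ :=
  ∫ y in Ω, k (x - y) * u y

variable {Ω : Set E} {k k' u u' : E → ℂ}

theorem integrable_convOn_integrand (hk : Integrable k) (hu : IntegrableOn u Ω) :
    Integrable (fun p : E × E => k (p.1 - p.2) * u p.2) (volume.prod (volume.restrict Ω)) := by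
  have := Integrable.convolution_integrand (ContinuousLinearMap.mul ℝ ℂ) hu hk
  simpa only [ContinuousLinearMap.mul_apply', mul_comm] using this

theorem integrable_convOn (hk : Integrable k) (hu : IntegrableOn u Ω) :
    Integrable (convOn Ω k u) :=
  (integrable_convOn_integrand hk hu).integral_prod_left

theorem ae_integrableOn_convOn (hk : Integrable k) (hu : IntegrableOn u Ω) :
    ∀ᵐ x, IntegrableOn (fun y => k (x - y) * u y) Ω :=
  (integrable_convOn_integrand hk hu).prod_right_ae

theorem integral_norm_convOn_le (hk : Integrable k) (hu : IntegrableOn u Ω) :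
    ∫ x in Ω, ‖convOn Ω k u x‖ ≤ (∫ x, ‖k x‖) * ∫ y in Ω, ‖u y‖ := by
  have hint := (integrable_convOn_integrand hk hu).norm
  calc ∫ x in Ω, ‖convOn Ω k u x‖
      ≤ ∫ x, ‖convOn Ω k u x‖ :=
        setIntegral_le_integral (integrable_convOn hk hu).norm
          (Eventually.of_forall fun x => norm_nonneg _)
    _ ≤ ∫ x, ∫ y in Ω, ‖k (x - y) * u y‖ :=
        integral_mono (integrable_convOn hk hu).norm hint.integral_prod_left
          fun x => norm_integral_le_integral_norm _
    _ = ∫ y in Ω, ∫ x, ‖k (x - y) * u y‖ := integral_integral_swap hint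
    _ = ∫ y in Ω, (∫ x, ‖k x‖) * ‖u y‖ := by
        congr 1 with y
        simp_rw [norm_mul]
        rw [integral_mul_const, integral_sub_right_eq_self (fun x => ‖k x‖)]
    _ = (∫ x, ‖k x‖) * ∫ y in Ω, ‖u y‖ := integral_const_mul _ _

theorem convOn_congr_ae (hk : k =ᵐ[volume] k') (hu : u =ᵐ[volume.restrict Ω] u') :
    convOn Ω k u = convOn Ω k' u' := by
  ext x
  have hkx : (fun y => k (x - y)) =ᵐ[volume.restrict Ω] fun y => k' (x - y) :=
    ae_restrict_of_ae
      ((quasiMeasurePreserving_sub_left_of_right_invariant volume x).ae_eq_comp hk)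
  exact integral_congr_ae (hkx.mul hu)

variable (Ω) in
/-- Convolution with an integrable kernel as an operator on `L¹(Ω)`, jointly continuous in the
kernel and the function. -/
noncomputable def convL1 :
    Lp ℂ 1 (volume : Measure E) →L[ℂ] Lp ℂ 1 (volume.restrict Ω) →L[ℂ] Lp ℂ 1 (volume.restrict Ω) :=
  LinearMap.mkContinuous₂
    (LinearMap.mk₂ ℂ
      (fun k u => ((integrable_convOn (L1.integrable_coeFn k) (L1.integrable_coeFn u)).restrict
        (s := Ω)).toL1 (convOn Ω k u))
      (fun k k' u => by
        rw [← Integrable.toL1_add, Integrable.toL1_eq_toL1_iff]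
        have hu := L1.integrable_coeFn u
        filter_upwards [ae_restrict_of_ae (ae_integrableOn_convOn (L1.integrable_coeFn k) hu),
          ae_restrict_of_ae (ae_integrableOn_convOn (L1.integrable_coeFn k') hu)] with x hx hx'
        rw [convOn_congr_ae (Lp.coeFn_add k k') (ae_eq_refl _)]
        simp only [convOn, Pi.add_apply, ← integral_add hx hx', add_mul])
      (fun c k u => by
        rw [← Integrable.toL1_smul, Integrable.toL1_eq_toL1_iff,
          convOn_congr_ae (Lp.coeFn_smul c k) (ae_eq_refl _)]
        refine Eventually.of_forall fun x => ?_
        simp only [convOn, Pi.smul_apply, smul_eq_mul, mul_assoc, integral_const_mul])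
      (fun k u u' => by
        rw [← Integrable.toL1_add, Integrable.toL1_eq_toL1_iff]
        have hk := L1.integrable_coeFn k
        filter_upwards [ae_restrict_of_ae (ae_integrableOn_convOn hk (L1.integrable_coeFn u)),
          ae_restrict_of_ae (ae_integrableOn_convOn hk (L1.integrable_coeFn u'))] with x hx hx'
        rw [convOn_congr_ae (ae_eq_refl _) (Lp.coeFn_add u u')]
        simp only [convOn, Pi.add_apply, ← integral_add hx hx', mul_add])
      (fun c k u => by
        rw [← Integrable.toL1_smul, Integrable.toL1_eq_toL1_iff,
          convOn_congr_ae (ae_eq_refl _) (Lp.coeFn_smul c u)]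
        refine Eventually.of_forall fun x => ?_
        simp only [convOn, Pi.smul_apply, smul_eq_mul, mul_left_comm, integral_const_mul]))
    1 (fun k u => by
      rw [one_mul, LinearMap.mk₂_apply, L1.norm_of_fun_eq_integral_norm, L1.norm_eq_integral_norm,
        L1.norm_eq_integral_norm]
      exact integral_norm_convOn_le (L1.integrable_coeFn k) (L1.integrable_coeFn u))

theorem coeFn_convL1 (k : Lp ℂ 1 (volume : Measure E)) (u : Lp ℂ 1 (volume.restrict Ω)) :
    convL1 Ω k u =ᵐ[volume.restrict Ω] convOn Ω k u :=
  Integrable.coeFn_toL1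
    ((integrable_convOn (L1.integrable_coeFn k) (L1.integrable_coeFn u)).restrict (s := Ω))

theorem integral_mul_convOn_comm (hk : Integrable k) (hk_even : ∀ x, k (-x) = k x)
    {a b : E → ℂ} (ha : IntegrableOn a Ω) (hb : MemLp b ∞ (volume.restrict Ω)) :
    ∫ x in Ω, b x * convOn Ω k a x = ∫ y in Ω, convOn Ω k b y * a y := by
  have hint : Integrable (fun p : E × E => b p.1 * (k (p.1 - p.2) * a p.2))
      ((volume.restrict Ω).prod (volume.restrict Ω)) :=
    ((integrable_convOn_integrand hk ha).mono_measure
      (Measure.prod_mono Measure.restrict_le_self le_rfl)).bdd_mul hb.aestronglyMeasurable.comp_fst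
      (Measure.quasiMeasurePreserving_fst.ae (ae_norm_le_of_memLp_top hb))
  calc ∫ x in Ω, b x * convOn Ω k a x
      = ∫ x in Ω, ∫ y in Ω, b x * (k (x - y) * a y) := by simp_rw [convOn, integral_const_mul]
    _ = ∫ y in Ω, ∫ x in Ω, b x * (k (x - y) * a y) := integral_integral_swap hint
    _ = ∫ y in Ω, convOn Ω k b y * a y := by
        congr 1 with y
        rw [convOn, ← integral_mul_const]
        congr 1 with x
        rw [← hk_even (x - y), neg_sub]
        ring

/-- The functional `g ↦ ∫ b g` on `L¹`, for an essentially bounded `b`. -/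
noncomputable def integralMulCLM {α : Type*} [MeasurableSpace α] {μ : Measure α} {b : α → ℂ}
    (hb : MemLp b ∞ μ) : Lp ℂ 1 μ →L[ℂ] ℂ :=
  (ContinuousLinearMap.mul ℂ ℂ).lpPairing μ ∞ 1 hb.toLp

theorem integralMulCLM_apply {α : Type*} [MeasurableSpace α] {μ : Measure α} {b : α → ℂ}
    (hb : MemLp b ∞ μ) (g : Lp ℂ 1 μ) : integralMulCLM hb g = ∫ x, b x * g x ∂μ := by
  rw [integralMulCLM, ContinuousLinearMap.lpPairing_eq_integral]
  refine integral_congr_ae ?_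
  filter_upwards [hb.coeFn_toLp] with x hx
  rw [hx, ContinuousLinearMap.mul_apply']

end Convolution

section Compactness

theorem norm_le_of_forall_ae_norm_le {α X : Type*} [MeasurableSpace α] {μ : Measure α}
    [IsFiniteMeasure μ] [NormedAddCommGroup X] [NormedSpace ℂ X] (A : X →L[ℂ] Lp ℂ 1 μ) {c : ℝ}
    (hc : 0 ≤ c) (hA : ∀ u, ∀ᵐ x ∂μ, ‖A u x‖ ≤ c * ‖u‖) : ‖A‖ ≤ c * μ.real Set.univ := by
  refine ContinuousLinearMap.opNorm_le_bound _ (by positivity) fun u => ?_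
  rw [L1.norm_eq_integral_norm]
  calc ∫ x, ‖A u x‖ ∂μ ≤ ∫ _, c * ‖u‖ ∂μ :=
        integral_mono_of_nonneg (Eventually.of_forall fun x => norm_nonneg _)
          (integrable_const _) (hA u)
    _ = c * μ.real Set.univ * ‖u‖ := by
        rw [integral_const, smul_eq_mul]
        ring

theorem exists_simpleFunc_edist_lt {α : Type*} [PseudoEMetricSpace α]
    [TopologicalSpace.SeparableSpace α] [Nonempty α] [MeasurableSpace α] [OpensMeasurableSpace α]
    {K : Set α} (hK : IsCompact K) {η : ℝ≥0∞} (hη : 0 < η) :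
    ∃ π : SimpleFunc α α, ∀ y ∈ K, edist (π y) y < η := by
  obtain ⟨t, ht⟩ := hK.elim_finite_subcover
    (fun k : ℕ => Metric.eball (TopologicalSpace.denseSeq α k) η) (fun k => Metric.isOpen_eball)
    (fun x _ => by
      obtain ⟨_, ⟨k, rfl⟩, hk⟩ := EMetric.mem_closure_iff.mp
        (TopologicalSpace.denseRange_denseSeq α x) η hη
      exact Set.mem_iUnion.mpr ⟨k, hk⟩)
  refine ⟨SimpleFunc.nearestPt (TopologicalSpace.denseSeq α) (t.sup id), fun y hy => ?_⟩
  obtain ⟨k, hk, hyk⟩ := Set.mem_iUnion₂.mp (ht hy)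
  exact (SimpleFunc.edist_nearestPt_le _ y (Finset.le_sup (f := id) hk)).trans_lt
    (edist_comm y _ ▸ hyk)

theorem sum_integral_fiber_mul {α β : Type*} [MeasurableSpace α] {μ : Measure α} {u : α → ℂ}
    (hu : Integrable u μ) (π : SimpleFunc α β) (c : β → ℂ) :
    ∑ p ∈ π.range, (∫ y, (π ⁻¹' {p}).indicator (fun _ => 1) y * u y ∂μ) * c p
      = ∫ y, c (π y) * u y ∂μ := by
  have hint (p : β) :
      Integrable (fun y => (π ⁻¹' {p}).indicator (fun _ => 1) y * u y * c p) μ := by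
    simp_rw [← Set.indicator_mul_left, one_mul]
    exact (hu.indicator (π.measurableSet_fiber p)).mul_const _
  simp_rw [← integral_mul_const]
  rw [← integral_finsetSum _ fun p _ => hint p]
  congr 1 with y
  rw [Finset.sum_eq_single (π y)]
  · rw [Set.indicator_of_mem (show y ∈ π ⁻¹' {π y} from rfl), one_mul, mul_comm]
  · intro p _ hp
    rw [Set.indicator_of_notMem (show y ∉ π ⁻¹' {p} from fun hy => hp (Eq.symm hy)), zero_mul,
      zero_mul]
  · exact fun h => absurd (SimpleFunc.mem_range_self π y) h

variable {E : Type*} [NormedAddCommGroup E] [MeasureSpace E] [BorelSpace E]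
  [(volume : Measure E).IsAddHaarMeasure] {Ω : Set E} {k : E → ℂ}

/-- The functional `u ↦ ∫_Ω u` restricted to the fiber of `π` over `p`. -/
noncomputable def fiberIntegralCLM (Ω : Set E) (π : SimpleFunc E E) (p : E) :
    Lp ℂ 1 (volume.restrict Ω) →L[ℂ] ℂ :=
  integralMulCLM ((memLp_top_const (1 : ℂ)).indicator (π.measurableSet_fiber p))

/-- The finite rank operator `u ↦ ∫_Ω k (x - π y) u(y) dy`, obtained from convolution with `k` by
sampling the kernel at the finitely many values of `π`. -/
noncomputable def sampledConvL1 (Ω : Set E) (hk : Integrable k) (π : SimpleFunc E E) :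
    Lp ℂ 1 (volume.restrict Ω) →L[ℂ] Lp ℂ 1 (volume.restrict Ω) :=
  ∑ p ∈ π.range, (fiberIntegralCLM Ω π p).smulRight ((hk.comp_sub_right p).restrict.toL1 _)

theorem isCompactOperator_sampledConvL1 (hk : Integrable k) (π : SimpleFunc E E) :
    IsCompactOperator (sampledConvL1 Ω hk π) :=
  Submodule.sum_mem (compactOperator (RingHom.id ℂ) _ _)
    fun _ _ => isCompactOperator_smulRight _ _

theorem coeFn_sampledConvL1 (hk : Integrable k) (π : SimpleFunc E E)
    (u : Lp ℂ 1 (volume.restrict Ω)) :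
    sampledConvL1 Ω hk π u =ᵐ[volume.restrict Ω] fun x => ∫ y in Ω, k (x - π y) * u y := by
  let g (p : E) : Lp ℂ 1 (volume.restrict Ω) := (hk.comp_sub_right p).restrict.toL1 _
  have hterm : ∀ᵐ x ∂volume.restrict Ω, ∀ p ∈ π.range,
      (fiberIntegralCLM Ω π p u • g p) x = fiberIntegralCLM Ω π p u * k (x - p) := by
    refine (Filter.eventually_all_finset π.range).mpr fun p _ => ?_
    filter_upwards [(hk.comp_sub_right p).restrict.coeFn_toL1,
      Lp.coeFn_smul (fiberIntegralCLM Ω π p u) (g p)] with x hx hsmul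
    rw [hsmul, Pi.smul_apply, hx, smul_eq_mul]
  filter_upwards [hterm, Lp.coeFn_fun_finsetSum π.range
    (fun p => fiberIntegralCLM Ω π p u • g p)] with x hterm hsum
  rw [← sum_integral_fiber_mul (L1.integrable_coeFn u) π (fun p => k (x - p)), sampledConvL1,
    sum_apply]
  refine hsum.trans (Finset.sum_congr rfl fun p hp => ?_)
  rw [hterm p hp, fiberIntegralCLM, integralMulCLM_apply]

variable [NormedSpace ℝ E] [FiniteDimensional ℝ E]

theorem norm_convL1_sub_sampledConvL1_le (hΩ : Bornology.IsBounded Ω) (hΩm : MeasurableSet Ω)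
    (hk : Continuous k) (hks : HasCompactSupport k) (hki : Integrable k) {π : SimpleFunc E E}
    {c : ℝ} (hc : 0 ≤ c) (hπ : ∀ x, ∀ y ∈ Ω, ‖k (x - y) - k (x - π y)‖ ≤ c) :
    ‖convL1 Ω (hki.toL1 k) - sampledConvL1 Ω hki π‖ ≤ c * volume.real Ω := by
  have : IsFiniteMeasure (volume.restrict Ω) := ⟨by simpa using hΩ.measure_lt_top⟩
  obtain ⟨D, hD⟩ := hk.bounded_above_of_compact_support hks
  rw [← measureReal_restrict_apply_univ]
  refine norm_le_of_forall_ae_norm_le _ hc fun u => ?_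
  have hu := L1.integrable_coeFn u
  filter_upwards [coeFn_sampledConvL1 hki π u, coeFn_convL1 (hki.toL1 k) u,
    Lp.coeFn_sub (convL1 Ω (hki.toL1 k) u) (sampledConvL1 Ω hki π u)] with x hsampled hconv hsub
  have hint : IntegrableOn (fun y => k (x - y) * u y) Ω :=
    hu.bdd_mul (c := D) (by fun_prop) (Eventually.of_forall fun y => hD _)
  have hint_sampled : IntegrableOn (fun y => k (x - π y) * u y) Ω :=
    hu.bdd_mul (c := D) (hk.comp_aestronglyMeasurable
      (aestronglyMeasurable_const.sub π.measurable.aestronglyMeasurable))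
      (Eventually.of_forall fun y => hD _)
  rw [sub_apply, hsub, Pi.sub_apply, hsampled, hconv,
    convOn_congr_ae hki.coeFn_toL1 (ae_eq_refl _), convOn, ← integral_sub hint hint_sampled,
    L1.norm_eq_integral_norm, ← integral_const_mul]
  refine norm_integral_le_of_norm_le (hu.norm.const_mul _) ?_
  filter_upwards [ae_restrict_mem hΩm] with y hy
  rw [← sub_mul, norm_mul]
  exact mul_le_mul_of_nonneg_right (hπ x y hy) (norm_nonneg _)

theorem isCompactOperator_convL1_toL1 (hΩ : Bornology.IsBounded Ω) (hΩm : MeasurableSet Ω)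
    (hk : Continuous k) (hks : HasCompactSupport k) (hki : Integrable k) :
    IsCompactOperator (convL1 Ω (hki.toL1 k)) := by
  refine isClosed_setOfPred_isCompactOperator.closure_subset (Metric.mem_closure_iff.mpr ?_)
  intro ε hε
  obtain ⟨c, hc, hcε⟩ : ∃ c > 0, volume.real Ω * c < ε := exists_pos_mul_lt hε _
  obtain ⟨η, hη, hkη⟩ := EMetric.uniformContinuous_iff.mp
    (hks.uniformContinuous_of_continuous hk) (ENNReal.ofReal c) (ENNReal.ofReal_pos.mpr hc)
  obtain ⟨π, hπ⟩ := exists_simpleFunc_edist_lt hΩ.isCompact_closure hη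
  refine ⟨sampledConvL1 Ω hki π, isCompactOperator_sampledConvL1 hki π, ?_⟩
  rw [dist_eq_norm]
  refine (norm_convL1_sub_sampledConvL1_le hΩ hΩm hk hks hki hc.le fun x y hy => ?_).trans_lt
    (mul_comm c _ ▸ hcε)
  rw [← dist_eq_norm, ← ENNReal.ofReal_le_ofReal_iff hc.le, ← edist_dist]
  refine (hkη ?_).le
  rw [edist_sub_left, edist_comm]
  exact hπ y (subset_closure hy)

theorem isCompactOperator_convL1 (hΩ : Bornology.IsBounded Ω) (hΩm : MeasurableSet Ω)
    (k : Lp ℂ 1 (volume : Measure E)) : IsCompactOperator (convL1 Ω k) := by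
  have hclosed : IsClosed {k : Lp ℂ 1 (volume : Measure E) | IsCompactOperator (convL1 Ω k)} :=
    isClosed_setOfPred_isCompactOperator.preimage (convL1 Ω).continuous
  refine hclosed.closure_subset (Metric.mem_closure_iff.mpr fun ε hε => ?_)
  obtain ⟨g, hgs, hkg, hgc, hgi⟩ :=
    (L1.integrable_coeFn k).exists_hasCompactSupport_integral_sub_le (half_pos hε)
  refine ⟨hgi.toL1 g, isCompactOperator_convL1_toL1 hΩ hΩm hgc hgs hgi, ?_⟩
  have hdist : ∫ x, ‖(k - hgi.toL1 g : Lp ℂ 1 volume) x‖ = ∫ x, ‖k x - g x‖ := by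
    refine integral_congr_ae ?_
    filter_upwards [Lp.coeFn_sub k (hgi.toL1 g), hgi.coeFn_toL1] with x hsub hg
    rw [hsub, Pi.sub_apply, hg]
  rw [dist_eq_norm, L1.norm_eq_integral_norm, hdist]
  exact hkg.trans_lt (half_lt_self hε)

end Compactness

section HolomorphicFamilies

theorem norm_deriv_le_of_forall_mem_ball {f : ℂ → ℂ} {ω : ℂ} {ρ B : ℝ}
    (hf : DifferentiableOn ℂ f (Metric.ball ω ρ)) (hB : ∀ z ∈ Metric.ball ω ρ, ‖f z‖ ≤ B)
    {z : ℂ} (hz : z ∈ Metric.ball ω (ρ / 2)) : ‖deriv f z‖ ≤ B / (ρ / 2) := by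
  have hsub : Metric.closedBall z (ρ / 2) ⊆ Metric.ball ω ρ :=
    Metric.closedBall_subset_ball' (by linarith [Metric.mem_ball.mp hz])
  exact Complex.norm_deriv_le_of_forall_mem_sphere_norm_le (dist_nonneg.trans_lt hz)
    ((hf.mono hsub).diffContOnCl_ball subset_rfl)
    fun w hw => hB w (hsub (Metric.sphere_subset_closedBall hw))

theorem norm_slope_le_of_forall_mem_ball {f : ℂ → ℂ} {ω : ℂ} {ρ B : ℝ}
    (hf : DifferentiableOn ℂ f (Metric.ball ω ρ)) (hB : ∀ z ∈ Metric.ball ω ρ, ‖f z‖ ≤ B)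
    {z : ℂ} (hz : z ∈ Metric.ball ω (ρ / 2)) : ‖slope f ω z‖ ≤ B / (ρ / 2) := by
  have hρ : 0 < ρ / 2 := dist_nonneg.trans_lt hz
  have hB0 : 0 ≤ B := (norm_nonneg _).trans (hB ω (Metric.mem_ball_self (by linarith)))
  have hsub : Metric.ball ω (ρ / 2) ⊆ Metric.ball ω ρ := Metric.ball_subset_ball (by linarith)
  have hmean := (convex_ball ω (ρ / 2)).norm_image_sub_le_of_norm_deriv_le
    (fun x hx => hf.differentiableAt (Metric.isOpen_ball.mem_nhds (hsub hx)))
    (fun x hx => norm_deriv_le_of_forall_mem_ball hf hB hx) (Metric.mem_ball_self hρ) hz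
  rw [slope_def_field, norm_div]
  exact div_le_of_le_mul₀ (norm_nonneg _) (by positivity) hmean

variable {α : Type*} [MeasurableSpace α] {μ : Measure α}

/-- The class in `L^p(μ)` of a function, with the junk value `0` when it is not in `L^p`. -/
noncomputable def toLpOrZero (p : ℝ≥0∞) (μ : Measure α) (f : α → ℂ) : Lp ℂ p μ :=
  open Classical in if hf : MemLp f p μ then hf.toLp f else 0

theorem coeFn_toLpOrZero {p : ℝ≥0∞} {f : α → ℂ} (hf : MemLp f p μ) :
    toLpOrZero p μ f =ᵐ[μ] f := by
  rw [toLpOrZero, dif_pos hf]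
  exact hf.coeFn_toLp

theorem coeFn_toLpOrZero_one {f : α → ℂ} (hf : Integrable f μ) : toLpOrZero 1 μ f =ᵐ[μ] f :=
  coeFn_toLpOrZero (memLp_one_iff_integrable.mpr hf)

/-- A family `κ z` of functions depending holomorphically on `z ∈ U` and dominated, for all `z ∈ U`
at once, by one integrable function. -/
structure IsDominatedHolomorphicOn (μ : Measure α) (κ : ℂ → α → ℂ) (U : Set ℂ) : Prop where
  aestronglyMeasurable : ∀ z, AEStronglyMeasurable (κ z) μ
  differentiableOn : ∀ᵐ x ∂μ, DifferentiableOn ℂ (fun z => κ z x) U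
  exists_bound : ∃ b : α → ℝ, Integrable b μ ∧ ∀ᵐ x ∂μ, ∀ z ∈ U, ‖κ z x‖ ≤ b x

namespace IsDominatedHolomorphicOn

variable {κ : ℂ → α → ℂ} {U : Set ℂ} {ω : ℂ}

theorem mono (h : IsDominatedHolomorphicOn μ κ U) {V : Set ℂ} (hV : V ⊆ U) :
    IsDominatedHolomorphicOn μ κ V where
  aestronglyMeasurable := h.aestronglyMeasurable
  differentiableOn := h.differentiableOn.mono fun _ hx => hx.mono hV
  exists_bound := by
    obtain ⟨b, hbi, hb⟩ := h.exists_bound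
    exact ⟨b, hbi, hb.mono fun x hx z hz => hx z (hV hz)⟩

theorem integrable (h : IsDominatedHolomorphicOn μ κ U) {z : ℂ} (hz : z ∈ U) :
    Integrable (κ z) μ := by
  obtain ⟨b, hbi, hb⟩ := h.exists_bound
  exact hbi.mono' (h.aestronglyMeasurable z) (hb.mono fun x hx => hx z hz)

theorem indicator {s : Set α} (hs : MeasurableSet s)
    (h : IsDominatedHolomorphicOn (μ.restrict s) κ U) :
    IsDominatedHolomorphicOn μ (fun z => s.indicator (κ z)) U where
  aestronglyMeasurable z := (aestronglyMeasurable_indicator_iff hs).mpr (h.aestronglyMeasurable z)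
  differentiableOn := by
    filter_upwards [(ae_restrict_iff' hs).mp h.differentiableOn] with x hx
    by_cases hxs : x ∈ s
    · simpa only [Set.indicator_of_mem hxs] using hx hxs
    · simpa only [Set.indicator_of_notMem hxs] using differentiableOn_const 0
  exists_bound := by
    obtain ⟨b, hbi, hb⟩ := h.exists_bound
    refine ⟨s.indicator b, (integrable_indicator_iff hs).mpr hbi, ?_⟩
    filter_upwards [(ae_restrict_iff' hs).mp hb] with x hx z hz
    by_cases hxs : x ∈ s
    · simpa only [Set.indicator_of_mem hxs] using hx hxs z hz
    · simp only [Set.indicator_of_notMem hxs, norm_zero, le_refl]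

theorem ae_tendsto_slope (h : IsDominatedHolomorphicOn μ κ U) (hU : U ∈ 𝓝 ω) :
    ∀ᵐ x ∂μ, Tendsto (fun z => slope (fun z => κ z x) ω z) (𝓝[≠] ω)
      (𝓝 (deriv (fun z => κ z x) ω)) := by
  filter_upwards [h.differentiableOn] with x hx
  exact (hx.differentiableAt hU).hasDerivAt.tendsto_slope

theorem aestronglyMeasurable_slope (h : IsDominatedHolomorphicOn μ κ U) (z : ℂ) :
    AEStronglyMeasurable (fun x => slope (fun z => κ z x) ω z) μ :=
  ((h.aestronglyMeasurable z).sub (h.aestronglyMeasurable ω)).const_smul (z - ω)⁻¹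

theorem aestronglyMeasurable_deriv (h : IsDominatedHolomorphicOn μ κ U) (hU : U ∈ 𝓝 ω) :
    AEStronglyMeasurable (fun x => deriv (fun z => κ z x) ω) μ :=
  aestronglyMeasurable_of_tendsto_ae (𝓝[≠] ω) h.aestronglyMeasurable_slope (h.ae_tendsto_slope hU)

theorem exists_bound_slope_deriv (h : IsDominatedHolomorphicOn μ κ U) (hU : U ∈ 𝓝 ω) :
    ∃ c : α → ℝ, Integrable c μ ∧ (∀ᵐ x ∂μ, ‖deriv (fun z => κ z x) ω‖ ≤ c x) ∧
      ∀ᶠ z in 𝓝 ω, ∀ᵐ x ∂μ, ‖slope (fun z => κ z x) ω z‖ ≤ c x := by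
  obtain ⟨ρ, hρ, hball⟩ := Metric.mem_nhds_iff.mp hU
  obtain ⟨b, hbi, hb⟩ := (h.mono hball).exists_bound
  have hd := (h.mono hball).differentiableOn
  refine ⟨fun x => b x / (ρ / 2), hbi.div_const _, ?_, ?_⟩
  · filter_upwards [hd, hb] with x hd hb
    exact norm_deriv_le_of_forall_mem_ball hd hb (Metric.mem_ball_self (half_pos hρ))
  · filter_upwards [Metric.ball_mem_nhds ω (half_pos hρ)] with z hz
    filter_upwards [hd, hb] with x hd hb
    exact norm_slope_le_of_forall_mem_ball hd hb hz

theorem integrable_deriv (h : IsDominatedHolomorphicOn μ κ U) (hU : U ∈ 𝓝 ω) :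
    Integrable (fun x => deriv (fun z => κ z x) ω) μ := by
  obtain ⟨c, hci, hc, -⟩ := h.exists_bound_slope_deriv hU
  exact hci.mono' (h.aestronglyMeasurable_deriv hU) hc

theorem hasDerivAt_toLpOrZero (h : IsDominatedHolomorphicOn μ κ U) (hU : U ∈ 𝓝 ω) :
    HasDerivAt (fun z => toLpOrZero 1 μ (κ z))
      (toLpOrZero 1 μ fun x => deriv (fun z => κ z x) ω) ω := by
  obtain ⟨c, hci, hc, hslope⟩ := h.exists_bound_slope_deriv hU
  rw [hasDerivAt_iff_tendsto_slope, tendsto_iff_norm_sub_tendsto_zero]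
  have hnorm : ∀ᶠ z in 𝓝[≠] ω,
      ∫ x, ‖slope (fun z => κ z x) ω z - deriv (fun z => κ z x) ω‖ ∂μ =
        ‖slope (fun z => toLpOrZero 1 μ (κ z)) ω z
          - toLpOrZero 1 μ fun x => deriv (fun z => κ z x) ω‖ := by
    filter_upwards [nhdsWithin_le_nhds hU] with z hz
    rw [L1.norm_eq_integral_norm]
    refine integral_congr_ae ?_
    set R := fun z => toLpOrZero 1 μ (κ z)
    filter_upwards [coeFn_toLpOrZero_one (h.integrable hz),
      coeFn_toLpOrZero_one (h.integrable (mem_of_mem_nhds hU)),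
      coeFn_toLpOrZero_one (h.integrable_deriv hU), Lp.coeFn_sub (R z) (R ω),
      Lp.coeFn_smul (z - ω)⁻¹ (R z - R ω), Lp.coeFn_sub (slope R ω z)
        (toLpOrZero 1 μ fun x => deriv (fun z => κ z x) ω)] with x hz hω hderiv hsub hsmul hdiff
    rw [hdiff, Pi.sub_apply, hderiv, slope_def_module, slope_def_module, hsmul, Pi.smul_apply, hsub,
      Pi.sub_apply, hz, hω]
  refine Tendsto.congr' hnorm ?_
  rw [← integral_zero α ℝ (μ := μ)]
  refine tendsto_integral_filter_of_dominated_convergence (fun x => c x + c x)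
    (Eventually.of_forall fun z =>
      ((h.aestronglyMeasurable_slope z).sub (h.aestronglyMeasurable_deriv hU)).norm) ?_
    (hci.add hci) ?_
  · filter_upwards [nhdsWithin_le_nhds hslope] with z hz
    filter_upwards [hz, hc] with x hz hc
    rw [norm_norm]
    exact (norm_sub_le _ _).trans (add_le_add hz hc)
  · filter_upwards [h.ae_tendsto_slope hU] with x hx
    exact tendsto_iff_norm_sub_tendsto_zero.mp hx

theorem hasStrictDerivAt_toLpOrZero (h : IsDominatedHolomorphicOn μ κ U) (hU : U ∈ 𝓝 ω) :
    HasStrictDerivAt (fun z => toLpOrZero 1 μ (κ z))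
      (toLpOrZero 1 μ fun x => deriv (fun z => κ z x) ω) ω := by
  have hd : DifferentiableOn ℂ (fun z => toLpOrZero 1 μ (κ z)) (interior U) := fun z hz =>
    (h.hasDerivAt_toLpOrZero
      (mem_interior_iff_mem_nhds.mp hz)).differentiableAt.differentiableWithinAt
  have hstrict := (hd.analyticAt (interior_mem_nhds.mpr hU)).hasStrictDerivAt
  rwa [(h.hasDerivAt_toLpOrZero hU).deriv] at hstrict

end IsDominatedHolomorphicOn

end HolomorphicFamilies

section Bootstrap

variable {E : Type*} [NormedAddCommGroup E] [MeasureSpace E] {Ω : Set E} {s v w : E → ℝ≥0∞}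

theorem enorm_convOn_mul_le {k g V u : E → ℂ} {c D : ℝ≥0∞} (hg : ∀ x, ‖g x‖ₑ ≤ D)
    (hV : ∀ᵐ x ∂volume.restrict Ω, ‖V x‖ₑ ≤ c) (hu : AEStronglyMeasurable u (volume.restrict Ω))
    (x : E) :
    ‖convOn Ω k (fun y => V y * u y) x‖ₑ ≤
      (∫⁻ y in Ω, ‖(k - g) (x - y)‖ₑ * c * ‖u y‖ₑ) + D * c * ∫⁻ y in Ω, ‖u y‖ₑ := by
  have hsplit (z : E) : ‖k z‖ₑ ≤ ‖(k - g) z‖ₑ + D :=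
    calc ‖k z‖ₑ = ‖(k - g) z + g z‖ₑ := by rw [Pi.sub_apply, sub_add_cancel]
      _ ≤ ‖(k - g) z‖ₑ + ‖g z‖ₑ := enorm_add_le _ _
      _ ≤ ‖(k - g) z‖ₑ + D := by gcongr; exact hg z
  calc ‖convOn Ω k (fun y => V y * u y) x‖ₑ
      ≤ ∫⁻ y in Ω, ‖k (x - y) * (V y * u y)‖ₑ := enorm_integral_le_lintegral_enorm _
    _ ≤ ∫⁻ y in Ω, (‖(k - g) (x - y)‖ₑ * c * ‖u y‖ₑ + D * c * ‖u y‖ₑ) := by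
        refine lintegral_mono_ae ?_
        filter_upwards [hV] with y hy
        rw [enorm_mul, enorm_mul, ← add_mul, ← add_mul, ← mul_assoc]
        gcongr
        exact hsplit _
    _ = (∫⁻ y in Ω, ‖(k - g) (x - y)‖ₑ * c * ‖u y‖ₑ) + D * c * ∫⁻ y in Ω, ‖u y‖ₑ := by
        rw [lintegral_add_right' _ (hu.enorm.const_mul _), lintegral_const_mul'' _ hu.enorm]

variable [NormedSpace ℝ E] [FiniteDimensional ℝ E] [BorelSpace E]
  [(volume : Measure E).IsAddHaarMeasure]

theorem lintegral_lintegral_sub_mul_le (hs : Measurable s)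
    (hv : AEMeasurable v (volume.restrict Ω)) :
    ∫⁻ x in Ω, ∫⁻ y in Ω, s (x - y) * v y ≤ (∫⁻ x, s x) * ∫⁻ y in Ω, v y :=
  calc ∫⁻ x in Ω, ∫⁻ y in Ω, s (x - y) * v y
      ≤ ∫⁻ x, ∫⁻ y in Ω, s (x - y) * v y := setLIntegral_le_lintegral _ _
    _ = ∫⁻ y in Ω, ∫⁻ x, s (x - y) * v y :=
        lintegral_lintegral_swap (AEMeasurable.mul (by fun_prop) hv.comp_snd)
    _ = ∫⁻ y in Ω, (∫⁻ x, s x) * v y := by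
        congr 1 with y
        rw [lintegral_mul_const _ (by fun_prop), lintegral_sub_right_eq_self s y]
    _ = (∫⁻ x, s x) * ∫⁻ y in Ω, v y := lintegral_const_mul'' _ hv

theorem ae_eq_zero_of_ae_le_lintegral (hs : Measurable s) (hs_lt : ∫⁻ x, s x < 1)
    (hv : AEMeasurable v (volume.restrict Ω)) (hv_fin : ∫⁻ y in Ω, v y ≠ ∞)
    (h : ∀ᵐ x ∂volume.restrict Ω, v x ≤ ∫⁻ y in Ω, s (x - y) * v y) :
    v =ᵐ[volume.restrict Ω] 0 := by
  rw [← lintegral_eq_zero_iff' hv]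
  by_contra hne
  have hle : ∫⁻ x in Ω, v x ≤ (∫⁻ x, s x) * ∫⁻ y in Ω, v y :=
    (lintegral_mono_ae h).trans (lintegral_lintegral_sub_mul_le hs hv)
  have hlt : (∫⁻ x, s x) * ∫⁻ y in Ω, v y < 1 * ∫⁻ y in Ω, v y :=
    ENNReal.mul_lt_mul_left hne hv_fin hs_lt
  exact absurd hle (not_le.mpr (hlt.trans_eq (one_mul _)))

theorem ae_le_two_mul_of_ae_le_lintegral_add (hs : Measurable s) (hs_le : ∫⁻ x, s x ≤ 2⁻¹)
    (hw : AEMeasurable w (volume.restrict Ω)) (hw_fin : ∫⁻ y in Ω, w y ≠ ∞) {B : ℝ≥0∞}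
    (h : ∀ᵐ x ∂volume.restrict Ω, w x ≤ (∫⁻ y in Ω, s (x - y) * w y) + B) :
    ∀ᵐ x ∂volume.restrict Ω, w x ≤ 2 * B := by
  have hmass (x : E) : ∫⁻ y in Ω, s (x - y) ≤ 2⁻¹ :=
    (setLIntegral_le_lintegral _ _).trans ((lintegral_sub_left_eq_self s x).trans_le hs_le)
  have hsub : ∀ᵐ x ∂volume.restrict Ω, w x - 2 * B ≤ ∫⁻ y in Ω, s (x - y) * (w y - 2 * B) := by
    filter_upwards [h] with x hx
    rw [tsub_le_iff_right]
    calc w x ≤ (∫⁻ y in Ω, s (x - y) * w y) + B := hx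
      _ ≤ (∫⁻ y in Ω, (s (x - y) * (w y - 2 * B) + s (x - y) * (2 * B))) + B := by
          gcongr with y
          rw [← mul_add]
          gcongr
          exact le_tsub_add
      _ = (∫⁻ y in Ω, s (x - y) * (w y - 2 * B)) + (∫⁻ y in Ω, s (x - y)) * (2 * B) + B := by
          rw [lintegral_add_right _ (by fun_prop), lintegral_mul_const _ (by fun_prop)]
      _ ≤ (∫⁻ y in Ω, s (x - y) * (w y - 2 * B)) + 2⁻¹ * (2 * B) + B := by
          gcongr
          exact hmass x
      _ = (∫⁻ y in Ω, s (x - y) * (w y - 2 * B)) + 2 * B := by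
          rw [← mul_assoc, ENNReal.inv_mul_cancel (by simp) (by simp), one_mul, add_assoc,
            two_mul]
  have hzero := ae_eq_zero_of_ae_le_lintegral (v := fun x => w x - 2 * B) hs
    (hs_le.trans_lt ENNReal.one_half_lt_one) (hw.sub_const _)
    (ne_top_of_le_ne_top hw_fin (lintegral_mono fun y => tsub_le_self)) hsub
  filter_upwards [hzero] with x hx
  exact tsub_eq_zero_iff_le.mp hx

-- Up to a small error in `L¹` the kernel is bounded, which turns the equation into an integral
-- inequality with a kernel of small mass.
theorem memLp_top_of_ae_eq_convOn_mul (k : Lp ℂ 1 (volume : Measure E)) {V u : E → ℂ}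
    (hV : MemLp V ∞ (volume.restrict Ω)) (hu : IntegrableOn u Ω)
    (h : u =ᵐ[volume.restrict Ω] convOn Ω k fun y => V y * u y) :
    MemLp u ∞ (volume.restrict Ω) := by
  obtain ⟨c, hc, hVc⟩ : ∃ c : ℝ≥0∞, (c ≠ 0 ∧ c ≠ ∞) ∧ ∀ᵐ x ∂volume.restrict Ω, ‖V x‖ₑ ≤ c :=
    ⟨eLpNorm V ∞ (volume.restrict Ω) + 1, ⟨by simp, by simpa using hV.eLpNorm_ne_top⟩,
      (enorm_ae_le_eLpNormEssSup V _).mono fun x hx => by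
        rw [eLpNorm_exponent_top]
        exact hx.trans le_self_add⟩
  obtain ⟨g, hgs, hkg, hgc, -⟩ :=
    (L1.integrable_coeFn k).exists_hasCompactSupport_lintegral_sub_le (ε := 2⁻¹ / c)
      (by simp [ENNReal.div_eq_zero_iff, hc.2])
  obtain ⟨D, hD⟩ := hgc.bounded_above_of_compact_support hgs
  have hgD (x : E) : ‖g x‖ₑ ≤ ENNReal.ofReal D := by
    rw [← ofReal_norm]
    exact ENNReal.ofReal_le_ofReal (hD x)
  have hmass : ∫⁻ x, ‖(⇑k - g) x‖ₑ * c ≤ 2⁻¹ := by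
    rw [lintegral_mul_const' _ _ hc.2]
    exact (mul_le_mul_left hkg c).trans_eq (ENNReal.div_mul_cancel hc.1 hc.2)
  have hmeas : Measurable fun x => ‖(⇑k - g) x‖ₑ * c :=
    (((Lp.stronglyMeasurable k).measurable.sub hgc.measurable).enorm).mul_const c
  have hbound := ae_le_two_mul_of_ae_le_lintegral_add hmeas hmass hu.1.enorm hu.2.ne
    (h.mono fun x hx => (congrArg enorm hx).trans_le (enorm_convOn_mul_le hgD hVc hu.1 x))
  refine ⟨hu.1, ?_⟩
  rw [eLpNorm_exponent_top]
  refine (eLpNormEssSup_le_of_ae_enorm_bound hbound).trans_lt ?_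
  exact ENNReal.mul_lt_top (by simp) (ENNReal.mul_lt_top
    (ENNReal.mul_lt_top ENNReal.ofReal_lt_top (lt_top_iff_ne_top.mpr hc.2)) hu.2)

end Bootstrap

section Kernels

variable {E : Type*} [NormedAddCommGroup E]

/-- The convolution kernel `z² G(|x|, z)` of `scatteringOp`. -/
noncomputable def kernelAt (G : ℝ → ℂ → ℂ) (z : ℂ) (x : E) : ℂ := z ^ 2 * G ‖x‖ z

theorem kernelAt_neg (G : ℝ → ℂ → ℂ) (z : ℂ) (x : E) :
    kernelAt G z (-x) = kernelAt G z x := by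
  rw [kernelAt, norm_neg, kernelAt]

/-- The derivative of `kernelAt` in the frequency. -/
noncomputable def kernelDerivAt (G : ℝ → ℂ → ℂ) (ω : ℂ) (x : E) : ℂ :=
  deriv (fun z => kernelAt G z x) ω

/-- The contrast `n² - 1` of the index `n` with the vacuum. -/
noncomputable def contrast (n : E → ℝ) (x : E) : ℂ := (n x : ℂ) ^ 2 - 1

/-- `G` gives rise to a convolution kernel that is holomorphic in the frequency on `U`, with
locally integrable bounds. -/
def IsHolomorphicKernelOn (E : Type*) [NormedAddCommGroup E] [MeasureSpace E] (G : ℝ → ℂ → ℂ)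
    (U : Set ℂ) : Prop :=
  ∀ D : ℝ, IsDominatedHolomorphicOn (volume.restrict (Metric.ball (0 : E) D)) (kernelAt G) U

/-- The kernel of `scatteringOp` cut off to the ball of radius `D`, as an element of `L¹`. -/
noncomputable def truncatedKernel (E : Type*) [NormedAddCommGroup E] [MeasureSpace E]
    (G : ℝ → ℂ → ℂ) (D : ℝ) (z : ℂ) : Lp ℂ 1 (volume : Measure E) :=
  toLpOrZero 1 volume ((Metric.ball 0 D).indicator (kernelAt G z))

/-- The derivative of `truncatedKernel` in the frequency. -/
noncomputable def truncatedKernelDeriv (E : Type*) [NormedAddCommGroup E] [MeasureSpace E]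
    (G : ℝ → ℂ → ℂ) (D : ℝ) (ω : ℂ) : Lp ℂ 1 (volume : Measure E) :=
  toLpOrZero 1 volume ((Metric.ball 0 D).indicator (kernelDerivAt G ω))

variable [MeasureSpace E] {G : ℝ → ℂ → ℂ} {Ω : Set E} {n : E → ℝ} {z ω : ℂ} {U : Set ℂ}
  {k g u u' : E → ℂ} {r D : ℝ}

theorem scatteringOp_eq_convOn :
    scatteringOp G Ω n z u = convOn Ω (kernelAt G z) (fun y => contrast n y * u y) := by
  ext x
  rw [scatteringOp, convOn, ← integral_const_mul]
  simp only [kernelAt, contrast, mul_assoc]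

theorem scatteringOp_congr_ae (h : u =ᵐ[volume.restrict Ω] u') :
    scatteringOp G Ω n z u = scatteringOp G Ω n z u' := by
  ext x
  rw [scatteringOp, scatteringOp]
  congr 1
  exact integral_congr_ae (h.mono fun y hy => by simp only [hy])

theorem scatteringOp_zero : scatteringOp G Ω n z 0 = 0 := by
  ext x
  simp [scatteringOp]

theorem convOn_indicator_ball (hΩm : MeasurableSet Ω) (hΩ : Ω ⊆ Metric.ball 0 r) {x : E}
    (hx : ‖x‖ + r ≤ D) : convOn Ω ((Metric.ball 0 D).indicator k) g x = convOn Ω k g x := by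
  refine setIntegral_congr_fun hΩm fun y hy => ?_
  have hxy : x - y ∈ Metric.ball (0 : E) D := by
    have hyr := mem_ball_zero_iff.mp (hΩ hy)
    exact mem_ball_zero_iff.mpr ((norm_sub_le x y).trans_lt (by linarith))
  simp only [Set.indicator_of_mem hxy]

variable [BorelSpace E]

theorem IsHolomorphicKernelOn.integrable_indicator_kernelAt (hK : IsHolomorphicKernelOn E G U)
    (hz : z ∈ U) (D : ℝ) : Integrable ((Metric.ball (0 : E) D).indicator (kernelAt G z)) :=
  IntegrableOn.integrable_indicator ((hK D).integrable hz) measurableSet_ball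

theorem IsHolomorphicKernelOn.integrable_indicator_kernelDerivAt
    (hK : IsHolomorphicKernelOn E G U) (hU : U ∈ 𝓝 ω) (D : ℝ) :
    Integrable ((Metric.ball (0 : E) D).indicator (kernelDerivAt G ω)) :=
  IntegrableOn.integrable_indicator ((hK D).integrable_deriv hU) measurableSet_ball

theorem IsHolomorphicKernelOn.coeFn_truncatedKernel (hK : IsHolomorphicKernelOn E G U)
    (hz : z ∈ U) (D : ℝ) :
    truncatedKernel E G D z =ᵐ[volume] (Metric.ball 0 D).indicator (kernelAt G z) :=
  coeFn_toLpOrZero_one (hK.integrable_indicator_kernelAt hz D)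

theorem IsHolomorphicKernelOn.coeFn_truncatedKernelDeriv (hK : IsHolomorphicKernelOn E G U)
    (hU : U ∈ 𝓝 ω) (D : ℝ) :
    truncatedKernelDeriv E G D ω =ᵐ[volume] (Metric.ball 0 D).indicator (kernelDerivAt G ω) :=
  coeFn_toLpOrZero_one (hK.integrable_indicator_kernelDerivAt hU D)

theorem IsHolomorphicKernelOn.hasStrictDerivAt_truncatedKernel
    (hK : IsHolomorphicKernelOn E G U) (hU : U ∈ 𝓝 ω) (D : ℝ) :
    HasStrictDerivAt (truncatedKernel E G D) (truncatedKernelDeriv E G D ω) ω := by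
  have h := ((hK D).indicator measurableSet_ball).hasStrictDerivAt_toLpOrZero hU
  have hderiv : (fun x => deriv (fun z => (Metric.ball (0 : E) D).indicator (kernelAt G z) x) ω)
      = (Metric.ball (0 : E) D).indicator (kernelDerivAt G ω) := by
    ext x
    by_cases hx : x ∈ Metric.ball (0 : E) D
    · simp only [Set.indicator_of_mem hx, kernelDerivAt]
    · simp only [Set.indicator_of_notMem hx, deriv_const]
  rwa [hderiv] at h

variable [NormedSpace ℝ E] [FiniteDimensional ℝ E] [(volume : Measure E).IsAddHaarMeasure]

theorem locallyIntegrable_convOn (hΩm : MeasurableSet Ω) (hΩ : Bornology.IsBounded Ω)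
    (hk : ∀ D, Integrable ((Metric.ball 0 D).indicator k)) (hg : IntegrableOn g Ω) :
    LocallyIntegrable (convOn Ω k g) := by
  obtain ⟨r, hr⟩ := hΩ.subset_ball 0
  intro x₀
  refine ⟨Metric.ball 0 (‖x₀‖ + 1), Metric.isOpen_ball.mem_nhds (by simp), ?_⟩
  refine (integrable_convOn (hk (‖x₀‖ + 1 + r)) hg).integrableOn.congr_fun (fun x hx => ?_)
    measurableSet_ball
  rw [convOn_indicator_ball hΩm hr]
  linarith [mem_ball_zero_iff.mp hx]

theorem exists_clm_eq_convOn (hΩm : MeasurableSet Ω) (hg : MemLp g ∞ (volume.restrict Ω))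
    (x : E) : ∃ l : Lp ℂ 1 (volume : Measure E) →L[ℂ] ℂ, ∀ k, l k = convOn Ω k g x := by
  have hreflect := (volume : Measure E).measurePreserving_sub_left x
  have hgx : MemLp (fun w => Ω.indicator g (x - w)) ∞ volume :=
    ((memLp_indicator_iff_restrict hΩm).mpr hg).comp_measurePreserving hreflect
  refine ⟨integralMulCLM hgx, fun k => ?_⟩
  rw [integralMulCLM_apply, convOn, ← integral_sub_left_eq_self _ volume x,
    ← integral_indicator hΩm]
  congr 1 with y
  rw [sub_sub_cancel, Set.indicator_mul_right, mul_comm]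

theorem IsHolomorphicKernelOn.hasDerivAt_convOn (hK : IsHolomorphicKernelOn E G U)
    (hU : U ∈ 𝓝 ω) (hΩm : MeasurableSet Ω) (hΩ : Bornology.IsBounded Ω)
    (hg : MemLp g ∞ (volume.restrict Ω)) (x : E) :
    HasDerivAt (fun z => convOn Ω (kernelAt G z) g x) (convOn Ω (kernelDerivAt G ω) g x) ω := by
  obtain ⟨r, hr⟩ := hΩ.subset_ball 0
  obtain ⟨l, hl⟩ := exists_clm_eq_convOn hΩm hg x
  have h := l.hasFDerivAt.comp_hasDerivAt ω
    (hK.hasStrictDerivAt_truncatedKernel hU (‖x‖ + r)).hasDerivAt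
  rw [hl, convOn_congr_ae (hK.coeFn_truncatedKernelDeriv hU _) (ae_eq_refl _),
    convOn_indicator_ball hΩm hr le_rfl] at h
  refine h.congr_of_eventuallyEq ?_
  filter_upwards [hU] with z hz
  rw [Function.comp_apply, hl, convOn_congr_ae (hK.coeFn_truncatedKernel hz _) (ae_eq_refl _),
    convOn_indicator_ball hΩm hr le_rfl]

theorem IsHolomorphicKernelOn.coeFn_convL1_truncatedKernel (hK : IsHolomorphicKernelOn E G U)
    (hz : z ∈ U) (hΩm : MeasurableSet Ω) (hr : Ω ⊆ Metric.ball 0 r)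
    (v : Lp ℂ 1 (volume.restrict Ω)) :
    convL1 Ω (truncatedKernel E G (r + r) z) v =ᵐ[volume.restrict Ω]
      convOn Ω (kernelAt G z) v := by
  filter_upwards [coeFn_convL1 (truncatedKernel E G (r + r) z) v, ae_restrict_mem hΩm]
    with x hx hxΩ
  rw [hx, convOn_congr_ae (hK.coeFn_truncatedKernel hz _) (ae_eq_refl _),
    convOn_indicator_ball hΩm hr (by linarith [mem_ball_zero_iff.mp (hr hxΩ)])]

theorem IsHolomorphicKernelOn.coeFn_convL1_truncatedKernelDeriv
    (hK : IsHolomorphicKernelOn E G U) (hU : U ∈ 𝓝 ω) (hΩm : MeasurableSet Ω)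
    (hr : Ω ⊆ Metric.ball 0 r) (v : Lp ℂ 1 (volume.restrict Ω)) :
    convL1 Ω (truncatedKernelDeriv E G (r + r) ω) v =ᵐ[volume.restrict Ω]
      convOn Ω (kernelDerivAt G ω) v := by
  filter_upwards [coeFn_convL1 (truncatedKernelDeriv E G (r + r) ω) v, ae_restrict_mem hΩm]
    with x hx hxΩ
  rw [hx, convOn_congr_ae (hK.coeFn_truncatedKernelDeriv hU _) (ae_eq_refl _),
    convOn_indicator_ball hΩm hr (by linarith [mem_ball_zero_iff.mp (hr hxΩ)])]

end Kernels

section ResonanceOperator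

/-- Multiplication of `L¹(μ)` by `L^∞(μ)`. -/
noncomputable def mulL1 {α : Type*} [MeasurableSpace α] (μ : Measure α) :
    Lp ℂ ∞ μ →L[ℂ] Lp ℂ 1 μ →L[ℂ] Lp ℂ 1 μ :=
  (ContinuousLinearMap.mul ℂ ℂ).holderL μ ∞ 1 1

theorem coeFn_mulL1 {α : Type*} [MeasurableSpace α] {μ : Measure α} (V : Lp ℂ ∞ μ)
    (v : Lp ℂ 1 μ) : mulL1 μ V v =ᵐ[μ] fun x => V x * v x :=
  ContinuousLinearMap.coeFn_holder _ _ _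

variable {E : Type*} [MeasureSpace E]

/-- The contrast of `n` as an element of `L^∞(Ω)`. -/
noncomputable def contrastLp (Ω : Set E) (n : E → ℝ) : Lp ℂ ∞ (volume.restrict Ω) :=
  toLpOrZero ∞ (volume.restrict Ω) (contrast n)

theorem coeFn_contrastLp {Ω : Set E} {n : E → ℝ}
    (hn : MemLp (contrast n) ∞ (volume.restrict Ω)) :
    contrastLp Ω n =ᵐ[volume.restrict Ω] contrast n :=
  coeFn_toLpOrZero hn

variable [NormedAddCommGroup E]

/-- The number `ω² ∫_Ω (n² - 1) u ∂_z(T_z u)|_{z = ω}`, which turns out to be `α⁻¹`. -/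
noncomputable def modeNormalization (G : ℝ → ℂ → ℂ) (Ω : Set E) (n : E → ℝ) (ω : ℂ)
    (u : E → ℂ) : ℂ :=
  ω ^ 2 * ∫ x in Ω, contrast n x * u x * deriv (fun z => scatteringOp G Ω n z u x) ω

variable {G : ℝ → ℂ → ℂ} {Ω : Set E} {n : E → ℝ} {z ω : ℂ} {U : Set ℂ} {u : E → ℂ} {r : ℝ}

theorem IsResonancePair.omega_ne_zero (hu : IsResonancePair G Ω n ω u) : ω ≠ 0 := by
  rintro rfl
  exact hu.2.1 (funext fun x => by simp [hu.2.2 x, scatteringOp])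

theorem IsResonancePair.not_ae_eq_zero (hu : IsResonancePair G Ω n ω u) :
    ¬ u =ᵐ[volume.restrict Ω] 0 := fun h =>
  hu.2.1 (funext fun x => by rw [hu.2.2 x, scatteringOp_congr_ae h, scatteringOp_zero])

theorem IsResonancePair.ne_zero_of_ae_eq (hu : IsResonancePair G Ω n z u)
    {v : Lp ℂ 1 (volume.restrict Ω)} (hv : v =ᵐ[volume.restrict Ω] u) : v ≠ 0 := by
  rintro rfl
  exact hu.not_ae_eq_zero (hv.symm.trans (Lp.coeFn_zero ℂ 1 _))

variable [NormedSpace ℝ E] [FiniteDimensional ℝ E]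

theorem IsResonancePair.integrableOn (hu : IsResonancePair G Ω n ω u)
    (hΩ : Bornology.IsBounded Ω) : IntegrableOn u Ω :=
  (hu.1.integrableOn_isCompact hΩ.isCompact_closure).mono_set subset_closure

variable [BorelSpace E] [(volume : Measure E).IsAddHaarMeasure]

theorem IsResonancePair.not_contrast_mul_ae_eq_zero (hu : IsResonancePair G Ω n ω u) :
    ¬ (fun x => contrast n x * u x) =ᵐ[volume.restrict Ω] 0 := by
  refine fun h => hu.2.1 (funext fun x => ?_)
  rw [hu.2.2 x, scatteringOp_eq_convOn, convOn_congr_ae (ae_eq_refl _) h]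
  simp [convOn]

/-- The operator `v ↦ ∫_Ω z² G(|· - y|, z) V(y) v(y) dy` on `L¹(Ω)`, as a function of the pair
`(V, z)`. Here `r` is any radius with `Ω ⊆ ball 0 r`; the kernel beyond `2r` plays no role. -/
noncomputable def resonanceOp (G : ℝ → ℂ → ℂ) (Ω : Set E) (r : ℝ)
    (q : Lp ℂ ∞ ((volume : Measure E).restrict Ω) × ℂ) :
    Lp ℂ 1 ((volume : Measure E).restrict Ω) →L[ℂ] Lp ℂ 1 ((volume : Measure E).restrict Ω) :=
  convL1 Ω (truncatedKernel E G (r + r) q.2) ∘L mulL1 _ q.1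

theorem isCompactOperator_resonanceOp (hΩm : MeasurableSet Ω) (hΩ : Bornology.IsBounded Ω)
    (q : Lp ℂ ∞ (volume.restrict Ω) × ℂ) : IsCompactOperator (resonanceOp G Ω r q) :=
  (isCompactOperator_convL1 hΩ hΩm _).comp_clm _

theorem IsHolomorphicKernelOn.exists_hasStrictFDerivAt_resonanceOp
    (hK : IsHolomorphicKernelOn E G U) (hU : U ∈ 𝓝 ω) (r : ℝ)
    (V : Lp ℂ ∞ (volume.restrict Ω)) :
    ∃ T' : (Lp ℂ ∞ (volume.restrict Ω) × ℂ) →L[ℂ]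
        Lp ℂ 1 (volume.restrict Ω) →L[ℂ] Lp ℂ 1 (volume.restrict Ω),
      HasStrictFDerivAt (resonanceOp G Ω r) T' (V, ω) ∧
      ∀ a ζ v, T' (a, ζ) v = convL1 Ω (truncatedKernel E G (r + r) ω) (mulL1 _ a v) +
        ζ • convL1 Ω (truncatedKernelDeriv E G (r + r) ω) (mulL1 _ V v) := by
  have hkernel : HasStrictFDerivAt
      (fun q : Lp ℂ ∞ (volume.restrict Ω) × ℂ => convL1 Ω (truncatedKernel E G (r + r) q.2)) _
      (V, ω) :=
    (convL1 Ω).hasStrictFDerivAt.comp (V, ω)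
      ((hK.hasStrictDerivAt_truncatedKernel hU (r + r)).hasStrictFDerivAt.comp (V, ω)
        hasStrictFDerivAt_snd)
  have hcontrast : HasStrictFDerivAt
      (fun q : Lp ℂ ∞ (volume.restrict Ω) × ℂ => mulL1 (volume.restrict Ω) q.1) _ (V, ω) :=
    (mulL1 _).hasStrictFDerivAt.comp (V, ω) hasStrictFDerivAt_fst
  refine ⟨_, hkernel.clm_comp hcontrast, fun a ζ v => ?_⟩
  simp

theorem IsHolomorphicKernelOn.coeFn_resonanceOp (hK : IsHolomorphicKernelOn E G U) (hz : z ∈ U)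
    (hΩm : MeasurableSet Ω) (hr : Ω ⊆ Metric.ball 0 r)
    (hn : MemLp (contrast n) ∞ (volume.restrict Ω)) (v : Lp ℂ 1 (volume.restrict Ω)) :
    resonanceOp G Ω r (contrastLp Ω n, z) v =ᵐ[volume.restrict Ω] scatteringOp G Ω n z v := by
  have hmul := (coeFn_mulL1 (contrastLp Ω n) v).trans ((coeFn_contrastLp hn).mul (ae_eq_refl v))
  refine (hK.coeFn_convL1_truncatedKernel hz hΩm hr _).trans (ae_of_all _ fun x => ?_)
  rw [scatteringOp_eq_convOn]
  exact congrFun (convOn_congr_ae (ae_eq_refl _) hmul) x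

theorem IsResonancePair.memLp_top (hu : IsResonancePair G Ω n ω u)
    (hK : IsHolomorphicKernelOn E G U) (hω : ω ∈ U) (hΩm : MeasurableSet Ω)
    (hΩ : Bornology.IsBounded Ω) (hn : MemLp (contrast n) ∞ (volume.restrict Ω)) :
    MemLp u ∞ (volume.restrict Ω) := by
  obtain ⟨r, hr⟩ := hΩ.subset_ball 0
  refine memLp_top_of_ae_eq_convOn_mul (truncatedKernel E G (r + r) ω) hn (hu.integrableOn hΩ) ?_
  filter_upwards [ae_restrict_mem hΩm] with x hx
  rw [convOn_congr_ae (hK.coeFn_truncatedKernel hω _) (ae_eq_refl _),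
    convOn_indicator_ball hΩm hr (by linarith [mem_ball_zero_iff.mp (hr hx)]),
    ← scatteringOp_eq_convOn, ← hu.2.2 x]

theorem IsResonancePair.resonanceOp_apply_eq (hu : IsResonancePair G Ω n z u)
    (hK : IsHolomorphicKernelOn E G U) (hz : z ∈ U) (hΩm : MeasurableSet Ω)
    (hr : Ω ⊆ Metric.ball 0 r) (hn : MemLp (contrast n) ∞ (volume.restrict Ω))
    {v : Lp ℂ 1 (volume.restrict Ω)} (hv : v =ᵐ[volume.restrict Ω] u) :
    resonanceOp G Ω r (contrastLp Ω n, z) v = v := by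
  refine Lp.ext ((hK.coeFn_resonanceOp hz hΩm hr hn v).trans ?_)
  filter_upwards [hv] with x hx
  rw [hx, scatteringOp_congr_ae hv, ← hu.2.2 x]

theorem IsHolomorphicKernelOn.locallyIntegrable_scatteringOp
    (hK : IsHolomorphicKernelOn E G U) (hz : z ∈ U) (hΩm : MeasurableSet Ω)
    (hΩ : Bornology.IsBounded Ω) (hn : MemLp (contrast n) ∞ (volume.restrict Ω))
    (hu : IntegrableOn u Ω) : LocallyIntegrable (scatteringOp G Ω n z u) := by
  rw [scatteringOp_eq_convOn]
  exact locallyIntegrable_convOn hΩm hΩ (hK.integrable_indicator_kernelAt hz)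
    (hu.mul_of_top_right hn)

theorem IsHolomorphicKernelOn.isResonancePair_scatteringOp (hK : IsHolomorphicKernelOn E G U)
    (hz : z ∈ U) (hΩm : MeasurableSet Ω) (hr : Ω ⊆ Metric.ball 0 r)
    (hn : MemLp (contrast n) ∞ (volume.restrict Ω)) {v : Lp ℂ 1 (volume.restrict Ω)}
    (hv0 : v ≠ 0) (hv : resonanceOp G Ω r (contrastLp Ω n, z) v = v) :
    IsResonancePair G Ω n z (scatteringOp G Ω n z v) := by
  have hae : scatteringOp G Ω n z v =ᵐ[volume.restrict Ω] v := by
    simpa only [hv] using (hK.coeFn_resonanceOp hz hΩm hr hn v).symm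
  refine ⟨hK.locallyIntegrable_scatteringOp hz hΩm (Metric.isBounded_ball.subset hr) hn
    (L1.integrable_coeFn v), fun h0 => hv0 ?_, fun x => ?_⟩
  · exact (Lp.eq_zero_iff_ae_eq_zero).mpr (by rw [← h0]; exact hae.symm)
  · rw [scatteringOp_congr_ae hae]

theorem IsHolomorphicKernelOn.mem_Res_iff (hK : IsHolomorphicKernelOn E G U) (hz : z ∈ U)
    (hΩm : MeasurableSet Ω) (hr : Ω ⊆ Metric.ball 0 r)
    (hn : MemLp (contrast n) ∞ (volume.restrict Ω)) :
    z ∈ Res G Ω n ↔ ∃ v, v ≠ 0 ∧ resonanceOp G Ω r (contrastLp Ω n, z) v = v := by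
  constructor
  · rintro ⟨u, hu⟩
    have hui := hu.integrableOn (Metric.isBounded_ball.subset hr)
    exact ⟨hui.toL1 u, hu.ne_zero_of_ae_eq hui.coeFn_toL1,
      hu.resonanceOp_apply_eq hK hz hΩm hr hn hui.coeFn_toL1⟩
  · rintro ⟨v, hv0, hv⟩
    exact ⟨_, hK.isResonancePair_scatteringOp hz hΩm hr hn hv0 hv⟩

theorem IsHolomorphicKernelOn.deriv_scatteringOp (hK : IsHolomorphicKernelOn E G U)
    (hU : U ∈ 𝓝 ω) (hΩm : MeasurableSet Ω) (hΩ : Bornology.IsBounded Ω)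
    (hg : MemLp (fun x => contrast n x * u x) ∞ (volume.restrict Ω)) (x : E) :
    deriv (fun z => scatteringOp G Ω n z u x) ω =
      convOn Ω (kernelDerivAt G ω) (fun y => contrast n y * u y) x := by
  simp_rw [scatteringOp_eq_convOn]
  exact (hK.hasDerivAt_convOn hU hΩm hΩ hg x).deriv

theorem IsResonancePair.memLp_contrast_mul (hu : IsResonancePair G Ω n ω u)
    (hK : IsHolomorphicKernelOn E G U) (hω : ω ∈ U) (hΩm : MeasurableSet Ω)
    (hΩ : Bornology.IsBounded Ω) (hn : MemLp (contrast n) ∞ (volume.restrict Ω)) :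
    MemLp (fun x => contrast n x * u x) ∞ (volume.restrict Ω) :=
  (hu.memLp_top hK hω hΩm hΩ hn).mul hn

theorem IsResonancePair.coeFn_convL1_kernelDeriv (hu : IsResonancePair G Ω n ω u)
    (hK : IsHolomorphicKernelOn E G U) (hU : U ∈ 𝓝 ω) (hΩm : MeasurableSet Ω)
    (hr : Ω ⊆ Metric.ball 0 r) (hn : MemLp (contrast n) ∞ (volume.restrict Ω))
    {v : Lp ℂ 1 (volume.restrict Ω)} (hv : v =ᵐ[volume.restrict Ω] u) :
    convL1 Ω (truncatedKernelDeriv E G (r + r) ω) (mulL1 _ (contrastLp Ω n) v)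
      =ᵐ[volume.restrict Ω] fun x => deriv (fun z => scatteringOp G Ω n z u x) ω := by
  have hΩ := Metric.isBounded_ball.subset hr
  have hmul := (coeFn_mulL1 (contrastLp Ω n) v).trans ((coeFn_contrastLp hn).mul hv)
  refine (hK.coeFn_convL1_truncatedKernelDeriv hU hΩm hr _).trans (ae_of_all _ fun x => ?_)
  simp only [hK.deriv_scatteringOp hU hΩm hΩ
    (hu.memLp_contrast_mul hK (mem_of_mem_nhds hU) hΩm hΩ hn)]
  exact congrFun (convOn_congr_ae (ae_eq_refl _) hmul) x

theorem IsNondegenerate.isSimpleFixedVector (hnd : IsNondegenerate G Ω n ω u)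
    (hu : IsResonancePair G Ω n ω u) (hK : IsHolomorphicKernelOn E G U) (hU : U ∈ 𝓝 ω)
    (hΩm : MeasurableSet Ω) (hr : Ω ⊆ Metric.ball 0 r)
    (hn : MemLp (contrast n) ∞ (volume.restrict Ω))
    {v : Lp ℂ 1 (volume.restrict Ω)} (hv : v =ᵐ[volume.restrict Ω] u) :
    IsSimpleFixedVector (resonanceOp G Ω r (contrastLp Ω n, ω)) v
      (convL1 Ω (truncatedKernelDeriv E G (r + r) ω) (mulL1 _ (contrastLp Ω n) v)) := by
  have hω := mem_of_mem_nhds hU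
  have hΩ := Metric.isBounded_ball.subset hr
  refine ⟨hu.ne_zero_of_ae_eq hv, hu.resonanceOp_apply_eq hK hω hΩm hr hn hv,
    fun w hw => ?_, fun w hw => hnd.2 ?_⟩
  · obtain rfl | hw0 := eq_or_ne w 0
    · exact ⟨0, (zero_smul ℂ v).symm⟩
    obtain ⟨c, hc⟩ := hnd.1 _ (hK.isResonancePair_scatteringOp hω hΩm hr hn hw0 hw)
    refine ⟨c, Lp.ext ?_⟩
    filter_upwards [hK.coeFn_resonanceOp hω hΩm hr hn w, hv, Lp.coeFn_smul c v] with x h1 h2 h3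
    rw [h3, Pi.smul_apply, h2, ← Pi.smul_apply, ← hc, ← h1, hw]
  · have hae : (fun x => scatteringOp G Ω n ω w x +
        deriv (fun z => scatteringOp G Ω n z u x) ω) =ᵐ[volume.restrict Ω] w := by
      filter_upwards [hK.coeFn_resonanceOp hω hΩm hr hn w,
        hu.coeFn_convL1_kernelDeriv hK hU hΩm hr hn hv,
        Lp.coeFn_sub w (resonanceOp G Ω r (contrastLp Ω n, ω) w)] with x h1 h2 h3
      rw [← h1, ← h2, ← hw, h3, Pi.sub_apply, add_sub_cancel]
    have hg := hu.memLp_contrast_mul hK hω hΩm hΩ hn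
    have hloc : LocallyIntegrable fun x => deriv (fun z => scatteringOp G Ω n z u x) ω := by
      simp only [hK.deriv_scatteringOp hU hΩm hΩ hg]
      exact locallyIntegrable_convOn hΩm hΩ (hK.integrable_indicator_kernelDerivAt hU)
        ((hu.integrableOn hΩ).mul_of_top_right hn)
    refine ⟨_, (hK.locallyIntegrable_scatteringOp hω hΩm hΩ hn (L1.integrable_coeFn w)).add hloc,
      fun x => ?_⟩
    rw [sub_eq_iff_eq_add']
    exact congrArg (· + _) (congrFun (scatteringOp_congr_ae hae) x).symm

theorem IsResonancePair.integral_contrast_mul_convL1 (hu : IsResonancePair G Ω n ω u)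
    (hK : IsHolomorphicKernelOn E G U) (hω : ω ∈ U) (hΩm : MeasurableSet Ω)
    (hr : Ω ⊆ Metric.ball 0 r) (hn : MemLp (contrast n) ∞ (volume.restrict Ω))
    (a : Lp ℂ 1 (volume.restrict Ω)) :
    ∫ x in Ω, contrast n x * u x * convL1 Ω (truncatedKernel E G (r + r) ω) a x =
      ∫ y in Ω, u y * a y := by
  set k := (Metric.ball (0 : E) (r + r)).indicator (kernelAt G ω) with hk
  have hk_even (x : E) : k (-x) = k x := by
    classical
    simp only [hk, Set.indicator_apply, mem_ball_zero_iff, norm_neg, kernelAt_neg]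
  have hΩ := Metric.isBounded_ball.subset hr
  have hbridge : convL1 Ω (truncatedKernel E G (r + r) ω) a =ᵐ[volume.restrict Ω]
      convOn Ω k a := by
    rw [← convOn_congr_ae (hK.coeFn_truncatedKernel hω _) (ae_eq_refl _)]
    exact coeFn_convL1 _ _
  calc ∫ x in Ω, contrast n x * u x * convL1 Ω (truncatedKernel E G (r + r) ω) a x
      = ∫ x in Ω, contrast n x * u x * convOn Ω k a x :=
        integral_congr_ae (hbridge.mono fun x hx => by simp only [hx])
    _ = ∫ y in Ω, convOn Ω k (fun y => contrast n y * u y) y * a y :=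
        integral_mul_convOn_comm (hK.integrable_indicator_kernelAt hω _) hk_even
          (L1.integrable_coeFn a) (hu.memLp_contrast_mul hK hω hΩm hΩ hn)
    _ = ∫ y in Ω, u y * a y := by
        refine setIntegral_congr_fun hΩm fun y hy => ?_
        simp only [hk]
        rw [convOn_indicator_ball hΩm hr (by linarith [mem_ball_zero_iff.mp (hr hy)]),
          ← scatteringOp_eq_convOn, ← hu.2.2 y]

theorem IsResonancePair.integral_contrast_mul_sub_resonanceOp (hu : IsResonancePair G Ω n ω u)
    (hK : IsHolomorphicKernelOn E G U) (hω : ω ∈ U) (hΩm : MeasurableSet Ω)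
    (hr : Ω ⊆ Metric.ball 0 r) (hn : MemLp (contrast n) ∞ (volume.restrict Ω))
    (w : Lp ℂ 1 (volume.restrict Ω)) :
    ∫ x in Ω, contrast n x * u x * (w - resonanceOp G Ω r (contrastLp Ω n, ω) w : Lp ℂ 1 _) x
      = 0 := by
  have hg := hu.memLp_contrast_mul hK hω hΩm (Metric.isBounded_ball.subset hr) hn
  rw [← integralMulCLM_apply hg, map_sub, integralMulCLM_apply, integralMulCLM_apply, sub_eq_zero]
  refine Eq.trans ?_ (hu.integral_contrast_mul_convL1 hK hω hΩm hr hn _).symm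
  refine integral_congr_ae ?_
  filter_upwards [coeFn_mulL1 (contrastLp Ω n) w, coeFn_contrastLp hn] with x h1 h2
  rw [mul_comm (contrast n x), mul_assoc, ← h2]
  exact congrArg (u x * ·) h1.symm

theorem integralMulCLM_ne_zero {α : Type*} [MeasurableSpace α] {μ : Measure α}
    [IsFiniteMeasure μ] {b : α → ℂ} (hb : MemLp b ∞ μ) (hb0 : ¬ b =ᵐ[μ] 0) :
    integralMulCLM hb ≠ 0 := by
  refine fun h => hb0 (hb.integrable le_top |>.ae_eq_zero_of_forall_setIntegral_eq_zero
    fun s hs hμs => ?_)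
  have hs1 := congrArg (fun l : Lp ℂ 1 μ →L[ℂ] ℂ => l (indicatorConstLp 1 hs hμs.ne 1)) h
  simp only [integralMulCLM_apply, zero_apply] at hs1
  rw [← hs1, ← integral_indicator hs]
  refine integral_congr_ae ?_
  filter_upwards [indicatorConstLp_coeFn (p := 1) (hs := hs) (hμs := hμs.ne) (c := (1 : ℂ))]
    with x hx
  by_cases hxs : x ∈ s <;> simp [hx, hxs]

theorem IsResonancePair.sq_mul_integral_convL1_kernelDeriv (hu : IsResonancePair G Ω n ω u)
    (hK : IsHolomorphicKernelOn E G U) (hU : U ∈ 𝓝 ω) (hΩm : MeasurableSet Ω)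
    (hr : Ω ⊆ Metric.ball 0 r) (hn : MemLp (contrast n) ∞ (volume.restrict Ω))
    {v : Lp ℂ 1 (volume.restrict Ω)} (hv : v =ᵐ[volume.restrict Ω] u) :
    ω ^ 2 * ∫ x in Ω, contrast n x * u x *
        convL1 Ω (truncatedKernelDeriv E G (r + r) ω) (mulL1 _ (contrastLp Ω n) v) x =
      modeNormalization G Ω n ω u :=
  congrArg (ω ^ 2 * ·) (integral_congr_ae
    ((ae_eq_refl _).mul (hu.coeFn_convL1_kernelDeriv hK hU hΩm hr hn hv)))

theorem IsNondegenerate.modeNormalization_ne_zero (hnd : IsNondegenerate G Ω n ω u)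
    (hu : IsResonancePair G Ω n ω u) (hK : IsHolomorphicKernelOn E G U) (hU : U ∈ 𝓝 ω)
    (hΩm : MeasurableSet Ω) (hΩ : Bornology.IsBounded Ω)
    (hn : MemLp (contrast n) ∞ (volume.restrict Ω)) : modeNormalization G Ω n ω u ≠ 0 := by
  have hω := mem_of_mem_nhds hU
  have : IsFiniteMeasure (volume.restrict Ω) := ⟨by simpa using hΩ.measure_lt_top⟩
  obtain ⟨r, hr⟩ := hΩ.subset_ball 0
  have hg := hu.memLp_contrast_mul hK hω hΩm hΩ hn
  have hv := (hu.integrableOn hΩ).coeFn_toL1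
  have hpair := (hnd.isSimpleFixedVector hu hK hU hΩm hr hn hv).apply_ne_zero
    (isCompactOperator_resonanceOp hΩm hΩ _)
    (integralMulCLM_ne_zero hg hu.not_contrast_mul_ae_eq_zero) fun w => by
      rw [integralMulCLM_apply, hu.integral_contrast_mul_sub_resonanceOp hK hω hΩm hr hn]
  rw [integralMulCLM_apply] at hpair
  rw [← hu.sq_mul_integral_convL1_kernelDeriv hK hU hΩm hr hn hv]
  exact mul_ne_zero (pow_ne_zero 2 hu.omega_ne_zero) hpair

theorem IsNondegenerate.exists_dual_mode (hnd : IsNondegenerate G Ω n ω u)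
    (hu : IsResonancePair G Ω n ω u) (hK : IsHolomorphicKernelOn E G U) (hU : U ∈ 𝓝 ω)
    (hΩm : MeasurableSet Ω) (hr : Ω ⊆ Metric.ball 0 r)
    (hn : MemLp (contrast n) ∞ (volume.restrict Ω))
    {v : Lp ℂ 1 (volume.restrict Ω)} (hv : v =ᵐ[volume.restrict Ω] u) :
    ∃ ψ : Lp ℂ 1 (volume.restrict Ω) →L[ℂ] ℂ,
      (∀ w, ψ (w - resonanceOp G Ω r (contrastLp Ω n, ω) w) = 0) ∧
      ψ (convL1 Ω (truncatedKernelDeriv E G (r + r) ω) (mulL1 _ (contrastLp Ω n) v)) = 1 ∧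
      ∀ a, ψ (convL1 Ω (truncatedKernel E G (r + r) ω) a) =
        (modeNormalization G Ω n ω u)⁻¹ * ω ^ 2 * ∫ x in Ω, u x * a x := by
  have hω := mem_of_mem_nhds hU
  have hΩ := Metric.isBounded_ball.subset hr
  refine ⟨((modeNormalization G Ω n ω u)⁻¹ * ω ^ 2) •
    integralMulCLM (hu.memLp_contrast_mul hK hω hΩm hΩ hn), fun w => ?_, ?_, fun a => ?_⟩
  · rw [smul_apply, integralMulCLM_apply,
      hu.integral_contrast_mul_sub_resonanceOp hK hω hΩm hr hn, smul_zero]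
  · rw [smul_apply, integralMulCLM_apply, smul_eq_mul, mul_assoc,
      hu.sq_mul_integral_convL1_kernelDeriv hK hU hΩm hr hn hv,
      inv_mul_cancel₀ (hnd.modeNormalization_ne_zero hu hK hU hΩm hΩ hn)]
  · rw [smul_apply, integralMulCLM_apply, smul_eq_mul,
      hu.integral_contrast_mul_convL1 hK hω hΩm hr hn]

theorem IsNondegenerate.exists_resonance_branch (hnd : IsNondegenerate G Ω n ω u)
    (hu : IsResonancePair G Ω n ω u) (hK : IsHolomorphicKernelOn E G U) (hU : U ∈ 𝓝 ω)
    (hΩm : MeasurableSet Ω) (hr : Ω ⊆ Metric.ball 0 r)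
    (hn : MemLp (contrast n) ∞ (volume.restrict Ω)) :
    ∃ W : Lp ℂ ∞ (volume.restrict Ω) → ℂ, W (contrastLp Ω n) = ω ∧
      (∀ᶠ q in 𝓝 (contrastLp Ω n, ω),
        (∃ v, v ≠ 0 ∧ resonanceOp G Ω r q v = v) ↔ q.2 = W q.1) ∧
      ∃ W' : Lp ℂ ∞ (volume.restrict Ω) →L[ℂ] ℂ, HasFDerivAt W W' (contrastLp Ω n) ∧
        ∀ a, W' a = -((modeNormalization G Ω n ω u)⁻¹ * ω ^ 2 * ∫ x in Ω, a x * u x ^ 2) := by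
  have hΩ := Metric.isBounded_ball.subset hr
  have hv := (hu.integrableOn hΩ).coeFn_toL1
  set v := (hu.integrableOn hΩ).toL1 u
  obtain ⟨ψ, hψ, hψf, hψK⟩ := hnd.exists_dual_mode hu hK hU hΩm hr hn hv
  obtain ⟨T', hT, hT'⟩ := hK.exists_hasStrictFDerivAt_resonanceOp hU r (contrastLp Ω n)
  have hf : T' (0, 1) v =
      convL1 Ω (truncatedKernelDeriv E G (r + r) ω) (mulL1 _ (contrastLp Ω n) v) := by
    simp [hT']
  obtain ⟨W, hW, hWiff, hWd⟩ := IsSimpleFixedVector.exists_branch hT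
    (isCompactOperator_resonanceOp hΩm hΩ _)
    (hf ▸ hnd.isSimpleFixedVector hu hK hU hΩm hr hn hv) hψ (hf ▸ hψf)
  refine ⟨W, hW, hWiff, _, hWd, fun a => ?_⟩
  have hpair : ∫ x in Ω, u x * mulL1 (volume.restrict Ω) a v x = ∫ x in Ω, a x * u x ^ 2 := by
    refine integral_congr_ae ?_
    filter_upwards [coeFn_mulL1 a v, hv] with x h1 h2
    rw [h1, h2]
    ring
  simp [hT', hψK, hpair]

end ResonanceOperator

section FirstVariation

variable {E : Type*} [MeasureSpace E]

theorem integral_conj_gradOmega_mul {Ω : Set E} {n n' : E → ℝ} {u : E → ℂ} (α ω : ℂ) :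
    ∫ x in Ω, conj (gradOmega α ω n u x) * ((n' x - n x : ℝ) : ℂ) =
      -(α * ω ^ 2 * (2 * ∫ x in Ω, n x * (n' x - n x) * u x ^ 2)) := by
  rw [← integral_const_mul, ← integral_const_mul, ← integral_neg]
  congr 1 with x
  simp only [gradOmega, map_mul, map_neg, map_pow, Complex.conj_conj, Complex.conj_ofReal,
    map_ofNat]
  push_cast
  ring

variable [NormedAddCommGroup E]

/-- The filter of neighbourhoods of `n` in the admissible class, for the `L^∞(Ω)` norm. -/
noncomputable def indexNhds (Ω : Set E) (nm np : ℝ) (n : E → ℝ) : Filter (E → ℝ) :=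
  comap (fun n' => supNorm Ω (n' - n)) (𝓝 0) ⊓ 𝓟 (Admissible Ω nm np)

variable {G : ℝ → ℂ → ℂ} {Ω : Set E} {nm np : ℝ} {n n' : E → ℝ} {ω : ℂ} {u w : E → ℂ}

theorem eventually_indexNhds {p : (E → ℝ) → Prop} :
    (∀ᶠ n' in indexNhds Ω nm np n, p n') ↔ ∃ δ : ℝ, 0 < δ ∧
      ∀ n' ∈ Admissible Ω nm np, supNorm Ω (n' - n) < ENNReal.ofReal δ → p n' := by
  rw [indexNhds, eventually_inf_principal, (ENNReal.nhds_zero_basis.comap _).eventually_iff]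
  constructor
  · rintro ⟨δ, hδ, h⟩
    refine ⟨(min δ 1).toReal, ENNReal.toReal_pos (by simp [hδ.ne']) (by simp), fun n' hn' hlt => ?_⟩
    rw [ENNReal.ofReal_toReal (by simp)] at hlt
    exact h (hlt.trans_le (min_le_left _ _)) hn'
  · rintro ⟨δ, hδ, h⟩
    exact ⟨_, ENNReal.ofReal_pos.mpr hδ, fun n' hlt hn' => h n' hn' hlt⟩

theorem eventually_mem_admissible : ∀ᶠ n' in indexNhds Ω nm np n, n' ∈ Admissible Ω nm np :=
  mem_inf_of_right (mem_principal_self _)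

theorem tendsto_supNorm_toReal :
    Tendsto (fun n' => (supNorm Ω (n' - n)).toReal) (indexNhds Ω nm np n) (𝓝 0) :=
  (ENNReal.tendsto_toReal ENNReal.zero_ne_top).comp (tendsto_comap.mono_left inf_le_left)

theorem hasFirstVariationAt_iff_isLittleO {J : (E → ℝ) → ℂ} {g : E → ℂ} :
    HasFirstVariationAt Ω nm np J n g ↔ IntegrableOn g Ω ∧
      (fun n' => J n' - J n - ∫ x in Ω, conj (g x) * ((n' x - n x : ℝ) : ℂ))
        =o[indexNhds Ω nm np n] fun n' => (supNorm Ω (n' - n)).toReal := by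
  simp only [HasFirstVariationAt, Asymptotics.isLittleO_iff, eventually_indexNhds,
    Real.norm_of_nonneg ENNReal.toReal_nonneg]

theorem isResonanceMapAt_of_eventually {W : (E → ℝ) → ℂ} (hW : W n = ω)
    (hWlim : Tendsto W (indexNhds Ω nm np n) (𝓝 ω)) {ε : ℝ} (hε : 0 < ε)
    (hRes : ∀ᶠ n' in indexNhds Ω nm np n, ∀ z ∈ Metric.ball ω ε, z ∈ Res G Ω n' ↔ z = W n') :
    IsResonanceMapAt G Ω nm np n ω W := by
  refine ⟨hW, ε, hε, eventually_indexNhds.mp ?_⟩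
  filter_upwards [hWlim (Metric.ball_mem_nhds ω hε), hRes] with n' hball hz
  refine ⟨hball, Set.ext fun z => ⟨fun h => (hz z h.2).mp h.1, ?_⟩⟩
  rintro rfl
  exact ⟨(hz _ hball).mpr rfl, hball⟩

theorem Admissible.ae_norm_le (hn : n ∈ Admissible Ω nm np) (hΩm : MeasurableSet Ω) :
    ∀ᵐ x ∂volume.restrict Ω, ‖n x‖ ≤ max |nm| |np| := by
  rw [ae_restrict_iff' hΩm]
  filter_upwards [hn.2.1] with x hx hxΩ
  exact abs_le_max_abs_abs (hx (subset_closure hxΩ)).1 (hx (subset_closure hxΩ)).2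

theorem Admissible.memLp (hn : n ∈ Admissible Ω nm np) (hΩm : MeasurableSet Ω) :
    MemLp n ∞ (volume.restrict Ω) :=
  memLp_top_of_bound hn.1.restrict.aestronglyMeasurable _ (Admissible.ae_norm_le hn hΩm)

theorem Admissible.memLp_ofReal (hn : n ∈ Admissible Ω nm np) (hΩm : MeasurableSet Ω) :
    MemLp (fun x => (n x : ℂ)) ∞ (volume.restrict Ω) :=
  (Admissible.memLp hn hΩm).ofReal

theorem Admissible.memLp_contrast (hn : n ∈ Admissible Ω nm np) (hΩm : MeasurableSet Ω) :
    MemLp (contrast n) ∞ (volume.restrict Ω) := by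
  have h := Admissible.memLp_ofReal hn hΩm
  have hsq : MemLp (fun x => (n x : ℂ) * n x) ∞ (volume.restrict Ω) := h.mul h
  refine (hsq.sub (memLp_top_const_enorm (c := (1 : ℂ)) (by simp))).ae_eq
    (ae_of_all _ fun x => ?_)
  simp only [Pi.sub_apply, contrast, sq]

theorem Admissible.ae_norm_sub_le (hn : n ∈ Admissible Ω nm np) (hn' : n' ∈ Admissible Ω nm np)
    (hΩm : MeasurableSet Ω) :
    ∀ᵐ x ∂volume.restrict Ω, ‖(n' x : ℂ) - n x‖ ≤ (supNorm Ω (n' - n)).toReal := by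
  filter_upwards [ae_norm_le_of_memLp_top
    ((Admissible.memLp hn' hΩm).sub (Admissible.memLp hn hΩm))] with x hx
  rwa [← Complex.ofReal_sub, Complex.norm_real]

theorem Admissible.norm_contrastLp_sub_le (hn : n ∈ Admissible Ω nm np)
    (hn' : n' ∈ Admissible Ω nm np) (hΩm : MeasurableSet Ω) :
    ‖contrastLp Ω n' - contrastLp Ω n‖ ≤
      2 * max |nm| |np| * (supNorm Ω (n' - n)).toReal := by
  have hbound : ∀ᵐ x ∂volume.restrict Ω, ‖(contrastLp Ω n' - contrastLp Ω n) x‖ ≤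
      2 * max |nm| |np| * (supNorm Ω (n' - n)).toReal := by
    filter_upwards [Lp.coeFn_sub (contrastLp Ω n') (contrastLp Ω n),
      coeFn_contrastLp (Admissible.memLp_contrast hn' hΩm),
      coeFn_contrastLp (Admissible.memLp_contrast hn hΩm), Admissible.ae_norm_sub_le hn hn' hΩm,
      Admissible.ae_norm_le hn hΩm, Admissible.ae_norm_le hn' hΩm] with x hsub h' h hdiff hb hb'
    have hfactor : contrast n' x - contrast n x = (n' x + n x : ℂ) * (n' x - n x) := by
      simp only [contrast]
      ring
    rw [hsub, Pi.sub_apply, h', h, hfactor, norm_mul]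
    have hsum : ‖(n' x + n x : ℂ)‖ ≤ 2 * max |nm| |np| := by
      refine (norm_add_le _ _).trans ?_
      rw [Complex.norm_real, Complex.norm_real]
      linarith
    gcongr
  rw [Lp.norm_def, eLpNorm_exponent_top]
  exact ENNReal.toReal_le_of_le_ofReal (by positivity) (eLpNormEssSup_le_of_ae_bound hbound)

theorem Admissible.isBigO_contrastLp_sub (hn : n ∈ Admissible Ω nm np) (hΩm : MeasurableSet Ω) :
    (fun n' => contrastLp Ω n' - contrastLp Ω n) =O[indexNhds Ω nm np n]
      fun n' => (supNorm Ω (n' - n)).toReal := by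
  refine Asymptotics.IsBigO.of_bound (2 * max |nm| |np|) ?_
  filter_upwards [eventually_mem_admissible] with n' hn'
  rw [Real.norm_of_nonneg ENNReal.toReal_nonneg]
  exact Admissible.norm_contrastLp_sub_le hn hn' hΩm

theorem Admissible.tendsto_contrastLp (hn : n ∈ Admissible Ω nm np) (hΩm : MeasurableSet Ω) :
    Tendsto (contrastLp Ω) (indexNhds Ω nm np n) (𝓝 (contrastLp Ω n)) :=
  tendsto_sub_nhds_zero_iff.mp
    ((Admissible.isBigO_contrastLp_sub hn hΩm).trans_tendsto tendsto_supNorm_toReal)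

theorem Admissible.integral_contrastLp_sub_mul (hn : n ∈ Admissible Ω nm np)
    (hn' : n' ∈ Admissible Ω nm np) (hΩm : MeasurableSet Ω) (hw : IntegrableOn w Ω) :
    ∫ x in Ω, (contrastLp Ω n' - contrastLp Ω n) x * w x =
      2 * (∫ x in Ω, n x * (n' x - n x) * w x) + ∫ x in Ω, (n' x - n x : ℂ) ^ 2 * w x := by
  have hn_mem := Admissible.memLp_ofReal hn hΩm
  have hdiff : MemLp (fun x => (n' x - n x : ℂ)) ∞ (volume.restrict Ω) :=
    (Admissible.memLp_ofReal hn' hΩm).sub hn_mem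
  have hlin : IntegrableOn (fun x => n x * (n' x - n x) * w x) Ω :=
    hw.mul_of_top_right (hdiff.mul hn_mem)
  have hquad : IntegrableOn (fun x => (n' x - n x : ℂ) ^ 2 * w x) Ω := by
    simp only [sq]
    exact hw.mul_of_top_right (hdiff.mul hdiff)
  rw [← integral_const_mul, ← integral_add (hlin.const_mul 2) hquad]
  refine integral_congr_ae ?_
  filter_upwards [Lp.coeFn_sub (contrastLp Ω n') (contrastLp Ω n),
    coeFn_contrastLp (Admissible.memLp_contrast hn' hΩm),
    coeFn_contrastLp (Admissible.memLp_contrast hn hΩm)] with x hsub h' h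
  rw [hsub, Pi.sub_apply, h', h, contrast, contrast]
  ring

theorem Admissible.isLittleO_integral_sq_mul (hn : n ∈ Admissible Ω nm np)
    (hΩm : MeasurableSet Ω) (hw : IntegrableOn w Ω) :
    (fun n' => ∫ x in Ω, (n' x - n x : ℂ) ^ 2 * w x) =o[indexNhds Ω nm np n]
      fun n' => (supNorm Ω (n' - n)).toReal := by
  have hO : (fun n' => ∫ x in Ω, (n' x - n x : ℂ) ^ 2 * w x) =O[indexNhds Ω nm np n]
      fun n' => (supNorm Ω (n' - n)).toReal ^ 2 := by
    refine Asymptotics.IsBigO.of_bound (∫ x in Ω, ‖w x‖) ?_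
    filter_upwards [eventually_mem_admissible] with n' hn'
    rw [Real.norm_of_nonneg (by positivity), mul_comm, ← integral_const_mul]
    refine norm_integral_le_of_norm_le (hw.norm.const_mul _) ?_
    filter_upwards [Admissible.ae_norm_sub_le hn hn' hΩm] with x hx
    rw [norm_mul, norm_pow]
    gcongr
  exact hO.trans_isLittleO
    ((Asymptotics.isLittleO_pow_id one_lt_two).comp_tendsto tendsto_supNorm_toReal)

theorem Admissible.integrableOn_gradOmega (hn : n ∈ Admissible Ω nm np) (hΩm : MeasurableSet Ω)
    (hu : IntegrableOn (fun x => u x ^ 2) Ω) (α : ℂ) : IntegrableOn (gradOmega α ω n u) Ω := by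
  have hconj : IntegrableOn (fun x => conj (u x ^ 2)) Ω := 
    Complex.conjLIE.integrable_comp_iff.mpr hu
  refine (hconj.mul_of_top_right ((Admissible.memLp_ofReal hn hΩm).const_mul
    (-2 * conj α * conj ω ^ 2))).congr (ae_of_all _ fun x => ?_)
  simp only [gradOmega, map_pow, Pi.mul_apply]

theorem Admissible.hasFirstVariationAt_comp_contrastLp (hn : n ∈ Admissible Ω nm np)
    (hΩm : MeasurableSet Ω) (hu : IntegrableOn (fun x => u x ^ 2) Ω) {α : ℂ}
    {W : Lp ℂ ∞ (volume.restrict Ω) → ℂ} {W' : Lp ℂ ∞ (volume.restrict Ω) →L[ℂ] ℂ}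
    (hW : HasFDerivAt W W' (contrastLp Ω n))
    (hW' : ∀ a, W' a = -(α * ω ^ 2 * ∫ x in Ω, a x * u x ^ 2)) :
    HasFirstVariationAt Ω nm np (fun n' => W (contrastLp Ω n')) n (gradOmega α ω n u) := by
  refine hasFirstVariationAt_iff_isLittleO.mpr
    ⟨Admissible.integrableOn_gradOmega hn hΩm hu α, ?_⟩
  have hlin := (hW.isLittleO.comp_tendsto (Admissible.tendsto_contrastLp hn hΩm)).trans_isBigO
    (Admissible.isBigO_contrastLp_sub hn hΩm)
  refine (hlin.sub ((Admissible.isLittleO_integral_sq_mul hn hΩm hu).const_mul_left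
    (α * ω ^ 2))).congr' ?_ EventuallyEq.rfl
  filter_upwards [eventually_mem_admissible] with n' hn'
  rw [integral_conj_gradOmega_mul, Function.comp_apply, hW',
    Admissible.integral_contrastLp_sub_mul hn hn' hΩm hu]
  ring

variable [BorelSpace E] [NormedSpace ℝ E] [FiniteDimensional ℝ E]
  [(volume : Measure E).IsAddHaarMeasure] {U : Set ℂ}

theorem exists_isResonanceMapAt_and_hasFirstVariationAt (hK : IsHolomorphicKernelOn E G U)
    (hU : U ∈ 𝓝 ω) (hΩm : MeasurableSet Ω) (hΩ : Bornology.IsBounded Ω)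
    (hn : n ∈ Admissible Ω nm np) (hu : IsResonancePair G Ω n ω u)
    (hnd : IsNondegenerate G Ω n ω u) :
    ∃ W : (E → ℝ) → ℂ, IsResonanceMapAt G Ω nm np n ω W ∧
      HasFirstVariationAt Ω nm np W n (gradOmega (modeNormalization G Ω n ω u)⁻¹ ω n u) := by
  obtain ⟨r, hr⟩ := hΩ.subset_ball 0
  have hcontrast := Admissible.memLp_contrast hn hΩm
  obtain ⟨W, hWn, hbranch, W', hW, hW'⟩ := hnd.exists_resonance_branch hu hK hU hΩm hr hcontrast
  have hW_cont : Tendsto (fun n' => W (contrastLp Ω n')) (indexNhds Ω nm np n) (𝓝 ω) := by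
    have h := hW.continuousAt.tendsto.comp (Admissible.tendsto_contrastLp hn hΩm)
    rwa [hWn] at h
  have hu_top := hu.memLp_top hK (mem_of_mem_nhds hU) hΩm hΩ hcontrast
  have hu_sq : IntegrableOn (fun x => u x ^ 2) Ω := by
    simp only [sq]
    exact (hu.integrableOn hΩ).mul_of_top_left hu_top
  rw [nhds_prod_eq] at hbranch
  obtain ⟨near, hnear, nearω, hnearω, hiff⟩ := eventually_prod_iff.mp hbranch
  obtain ⟨ε, hε, hball⟩ := Metric.eventually_nhds_iff_ball.mp (hnearω.and hU)
  refine ⟨fun n' => W (contrastLp Ω n'), isResonanceMapAt_of_eventually hWn hW_cont hε ?_,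
    Admissible.hasFirstVariationAt_comp_contrastLp hn hΩm hu_sq hW hW'⟩
  filter_upwards [eventually_mem_admissible,
    (Admissible.tendsto_contrastLp hn hΩm).eventually hnear] with n' hn' hnear' z hz
  obtain ⟨hzω, hzU⟩ := hball z hz
  rw [hK.mem_Res_iff hzU hΩm hr (Admissible.memLp_contrast hn' hΩm)]
  exact hiff hnear' hzω

end FirstVariation

section GreenFunctions

theorem differentiable_tsum_mul_pow {a : ℕ → ℂ} (ha : ∀ k, ‖a k‖ ≤ 1 / (k ! : ℝ)) :
    Differentiable ℂ fun z : ℂ => ∑' k : ℕ, a k * (z / 2) ^ (2 * k) := by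
  intro z₀
  have hz₀ : z₀ ∈ Metric.ball (0 : ℂ) (‖z₀‖ + 1) := by simp
  refine (Complex.differentiableOn_tsum_of_summable_norm
    (u := fun k : ℕ => (((‖z₀‖ + 1) / 2) ^ 2) ^ k / (k ! : ℝ))
    (Real.summable_pow_div_factorial _) (fun k => by fun_prop) Metric.isOpen_ball
    (fun k z hz => ?_)).differentiableAt (Metric.isOpen_ball.mem_nhds hz₀)
  rw [mem_ball_zero_iff] at hz
  rw [norm_mul, norm_pow, norm_div, Complex.norm_ofNat, pow_mul, div_eq_mul_one_div _ (k ! : ℝ),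
    mul_comm]
  have hak := ha k
  gcongr

theorem differentiable_besselJ0 : Differentiable ℂ besselJ0 := by
  refine differentiable_tsum_mul_pow (a := fun k => (-1 : ℂ) ^ k / (k ! : ℂ) ^ 2) fun k => ?_
  rw [norm_div, norm_pow, norm_neg, norm_one, one_pow, norm_pow, Complex.norm_natCast]
  gcongr
  exact le_self_pow₀ (by exact_mod_cast k.factorial_pos) two_ne_zero

theorem harmonic_le_self (k : ℕ) : harmonic k ≤ k := by
  rw [harmonic]
  refine (Finset.sum_le_card_nsmul _ _ 1 fun i _ => ?_).trans (by simp)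
  exact inv_le_one_of_one_le₀ (by push_cast; linarith [i.cast_nonneg (α := ℚ)])

theorem norm_harmonic_le_factorial (k : ℕ) : ‖((harmonic k : ℚ) : ℂ)‖ ≤ (k ! : ℝ) := by
  have hnonneg : (0 : ℚ) ≤ harmonic k := Finset.sum_nonneg fun i _ => by positivity
  rw [← Complex.ofReal_ratCast, Complex.norm_real,
    Real.norm_of_nonneg (by exact_mod_cast hnonneg)]
  calc ((harmonic k : ℚ) : ℝ) ≤ ((k : ℚ) : ℝ) := by exact_mod_cast harmonic_le_self k
    _ = (k : ℝ) := by simp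
    _ ≤ (k ! : ℝ) := by exact_mod_cast k.self_le_factorial

theorem differentiable_hankelH0_zero_right : Differentiable ℂ fun w => hankelH0 w 0 := by
  have hseries : Differentiable ℂ fun z : ℂ =>
      ∑' k : ℕ, (-1 : ℂ) ^ (k + 1) * ((harmonic k : ℚ) : ℂ) / (k ! : ℂ) ^ 2 *
        (z / 2) ^ (2 * k) := by
    refine differentiable_tsum_mul_pow
      (a := fun k => (-1 : ℂ) ^ (k + 1) * ((harmonic k : ℚ) : ℂ) / (k ! : ℂ) ^ 2) fun k => ?_
    have hk : (0 : ℝ) < (k ! : ℝ) := by exact_mod_cast k.factorial_pos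
    rw [norm_div, norm_mul, norm_pow, norm_neg, norm_one, one_pow, one_mul, norm_pow,
      Complex.norm_natCast, div_le_div_iff₀ (by positivity) hk, one_mul, sq]
    exact mul_le_mul_of_nonneg_right (norm_harmonic_le_factorial k) hk.le
  have hJ := differentiable_besselJ0
  unfold hankelH0 besselY0
  fun_prop

theorem hankelH0_eq_add (w lz : ℂ) :
    hankelH0 w lz = hankelH0 w 0 + Complex.I * (2 / (Real.pi : ℂ)) * lz * besselJ0 w := by
  rw [hankelH0, hankelH0, besselY0, besselY0]
  ring

theorem exists_norm_hankelH0_le (A : ℝ) :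
    ∃ M : ℝ, 0 ≤ M ∧ ∀ w lz : ℂ, ‖w‖ ≤ A → ‖hankelH0 w lz‖ ≤ M * (1 + ‖lz‖) := by
  have hA : IsCompact (Metric.closedBall (0 : ℂ) A) := isCompact_closedBall _ _
  obtain ⟨M₀, hM₀⟩ := hA.exists_bound_of_continuousOn
    differentiable_hankelH0_zero_right.continuous.continuousOn
  obtain ⟨M₁, hM₁⟩ := hA.exists_bound_of_continuousOn (f := fun w =>
    Complex.I * (2 / (Real.pi : ℂ)) * besselJ0 w)
    (differentiable_besselJ0.continuous.const_mul _).continuousOn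
  refine ⟨max 0 (max M₀ M₁), le_max_left _ _, fun w lz hw => ?_⟩
  have hwA := mem_closedBall_zero_iff.mpr hw
  calc ‖hankelH0 w lz‖
      ≤ ‖hankelH0 w 0‖ + ‖Complex.I * (2 / (Real.pi : ℂ)) * besselJ0 w‖ * ‖lz‖ := by
        rw [hankelH0_eq_add, mul_right_comm, ← norm_mul]
        exact norm_add_le _ _
    _ ≤ max 0 (max M₀ M₁) + max 0 (max M₀ M₁) * ‖lz‖ := by
        gcongr
        · exact (hM₀ w hwA).trans ((le_max_left _ _).trans (le_max_right _ _))
        · exact (hM₁ w hwA).trans ((le_max_right _ _).trans (le_max_right _ _))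
    _ = max 0 (max M₀ M₁) * (1 + ‖lz‖) := by ring

variable {E : Type*} [NormedAddCommGroup E] [NormedSpace ℝ E] [FiniteDimensional ℝ E]
  [MeasureSpace E] [BorelSpace E] [(volume : Measure E).IsAddHaarMeasure] [Nontrivial E]

theorem integrableOn_ball_of_continuous_div_norm_pow {h : ℝ → ℝ} (hh : Continuous h) (D : ℝ) :
    IntegrableOn (fun x : E => h ‖x‖ / ‖x‖ ^ (Module.finrank ℝ E - 1)) (Metric.ball 0 D) := by
  rw [integrableOn_fun_norm_addHaar volume (f := fun r => h r / r ^ (Module.finrank ℝ E - 1))]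
  have hint : IntegrableOn h (Set.Ioo 0 D) :=
    (hh.integrableOn_Icc (a := 0) (b := D)).mono_set Set.Ioo_subset_Icc_self
  refine hint.congr_fun (fun r hr => ?_) measurableSet_Ioo
  rw [smul_eq_mul, mul_div_cancel₀ _ (pow_ne_zero _ hr.1.ne')]

theorem isHolomorphicKernelOn_of_radial_bound {G : ℝ → ℂ → ℂ} {U : Set ℂ}
    (hmeas : ∀ z, Measurable fun r => G r z)
    (hdiff : ∀ r : ℝ, 0 < r → DifferentiableOn ℂ (fun z => z ^ 2 * G r z) U)
    (hbound : ∀ D : ℝ, ∃ h : ℝ → ℝ, Continuous h ∧ ∀ r : ℝ, 0 < r → r < D → ∀ z ∈ U,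
      r ^ (Module.finrank ℝ E - 1) * ‖z ^ 2 * G r z‖ ≤ h r) :
    IsHolomorphicKernelOn E G U := by
  intro D
  obtain ⟨h, hh, hle⟩ := hbound D
  have hpos : ∀ᵐ x ∂volume.restrict (Metric.ball (0 : E) D), 0 < ‖x‖ :=
    ae_restrict_of_ae ((Measure.ae_ne volume (0 : E)).mono fun x hx => norm_pos_iff.mpr hx)
  refine ⟨fun z => ?_, hpos.mono fun x hx => hdiff ‖x‖ hx,
    _, integrableOn_ball_of_continuous_div_norm_pow hh D, ?_⟩
  · exact (((hmeas z).comp measurable_norm).const_mul _).aestronglyMeasurable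
  · filter_upwards [hpos, ae_restrict_mem measurableSet_ball] with x hx hxD z hz
    rw [le_div_iff₀' (by positivity)]
    exact hle ‖x‖ hx (mem_ball_zero_iff.mp hxD) z hz

theorem norm_exp_I_mul_le {z : ℂ} {r A D : ℝ} (hr : 0 < r) (hrD : r < D)
    (hz : z ∈ Metric.ball 0 A) : ‖Complex.exp (Complex.I * z * r)‖ ≤ Real.exp (A * D) := by
  rw [mem_ball_zero_iff] at hz
  rw [Complex.norm_exp]
  refine Real.exp_le_exp.mpr ((Complex.re_le_norm _).trans ?_)
  rw [norm_mul, norm_mul, Complex.norm_I, one_mul, Complex.norm_real, Real.norm_of_nonneg hr.le]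
  have hA := (norm_nonneg z).trans hz.le
  gcongr

theorem sq_mul_green1 (r : ℝ) (z : ℂ) :
    z ^ 2 * green1 r z = -(2 * Complex.I)⁻¹ * z * Complex.exp (Complex.I * z * r) := by
  rw [green1]
  by_cases hz : z = 0
  · simp [hz]
  · field_simp

theorem isHolomorphicKernelOn_green1 (A : ℝ) :
    IsHolomorphicKernelOn E green1 (Metric.ball 0 A) := by
  refine isHolomorphicKernelOn_of_radial_bound (fun z => by unfold green1; fun_prop)
    (fun r _ => by simp_rw [sq_mul_green1]; fun_prop) fun D =>
    ⟨fun r => r ^ (Module.finrank ℝ E - 1) * (‖-(2 * Complex.I)⁻¹‖ * A * Real.exp (A * D)),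
      by fun_prop, fun r hr hrD z hz => ?_⟩
  have hexp := norm_exp_I_mul_le hr hrD hz
  rw [mem_ball_zero_iff] at hz
  have hA := (norm_nonneg z).trans hz.le
  rw [sq_mul_green1, norm_mul, norm_mul]
  beta_reduce
  gcongr

theorem isHolomorphicKernelOn_green3 (hE : Module.finrank ℝ E = 3) (A : ℝ) :
    IsHolomorphicKernelOn E green3 (Metric.ball 0 A) := by
  refine isHolomorphicKernelOn_of_radial_bound (fun z => by unfold green3; fun_prop)
    (fun r _ => by unfold green3; fun_prop) fun D =>
    ⟨fun r => A ^ 2 * (4 * Real.pi)⁻¹ * Real.exp (A * D) * r, by fun_prop,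
      fun r hr hrD z hz => ?_⟩
  have hexp := norm_exp_I_mul_le hr hrD hz
  rw [mem_ball_zero_iff] at hz
  have hpi := Real.pi_pos
  have hcoeff : ‖(4 * (Real.pi : ℂ) * (r : ℂ))⁻¹‖ = (4 * Real.pi)⁻¹ * r⁻¹ := by
    rw [norm_inv, norm_mul, norm_mul, Complex.norm_real, Complex.norm_real,
      Real.norm_of_nonneg hr.le, Real.norm_of_nonneg hpi.le, Complex.norm_ofNat, mul_inv]
  calc r ^ (Module.finrank ℝ E - 1) * ‖z ^ 2 * green3 r z‖
      = ‖z‖ ^ 2 * (4 * Real.pi)⁻¹ * ‖Complex.exp (Complex.I * z * r)‖ * r := by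
        rw [hE, green3, norm_mul, norm_mul, norm_pow, hcoeff]
        field_simp
        exact mul_comm _ _
    _ ≤ A ^ 2 * (4 * Real.pi)⁻¹ * Real.exp (A * D) * r := by gcongr

theorem differentiableAt_green2 {lg : ℂ → ℂ} {z : ℂ} (hlg : DifferentiableAt ℂ lg z) (r : ℝ) :
    DifferentiableAt ℂ (green2 lg r) z := by
  have hJ : DifferentiableAt ℂ (fun z : ℂ => besselJ0 (z * r)) z :=
    (differentiable_besselJ0.comp (by fun_prop : Differentiable ℂ fun z : ℂ => z * r)) z
  have hH : DifferentiableAt ℂ (fun z : ℂ => hankelH0 (z * r) 0) z :=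
    (differentiable_hankelH0_zero_right.comp (by fun_prop : Differentiable ℂ fun z : ℂ => z * r)) z
  unfold green2
  simp_rw [hankelH0_eq_add _ (_ + _)]
  fun_prop

theorem measurable_green2 (lg : ℂ → ℂ) (z : ℂ) : Measurable fun r => green2 lg r z := by
  have hJ : Measurable fun r : ℝ => besselJ0 (z * r) :=
    (differentiable_besselJ0.continuous.comp (by fun_prop)).measurable
  have hH : Measurable fun r : ℝ => hankelH0 (z * r) 0 :=
    (differentiable_hankelH0_zero_right.continuous.comp
      (by fun_prop : Continuous fun r : ℝ => z * r)).measurable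
  unfold green2
  simp_rw [hankelH0_eq_add _ (_ + _)]
  fun_prop

theorem exists_norm_sq_mul_green2_le {A B : ℝ} (D : ℝ) {lg : ℂ → ℂ} :
    ∃ M : ℝ, ∀ r : ℝ, 0 < r → r < D → ∀ z ∈ Metric.ball (0 : ℂ) A, ‖lg z‖ ≤ B →
      ‖z ^ 2 * green2 lg r z‖ ≤ M * (1 + B + |Real.log r|) := by
  obtain ⟨M, hM, hH⟩ := exists_norm_hankelH0_le (A * D)
  refine ⟨A ^ 2 * (‖-(4 * Complex.I)⁻¹‖ * M), fun r hr hrD z hz hlg => ?_⟩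
  have hzA := (mem_ball_zero_iff.mp hz).le
  have hA := (norm_nonneg z).trans hzA
  have hzr : ‖z * r‖ ≤ A * D := by
    rw [norm_mul, Complex.norm_real, Real.norm_of_nonneg hr.le]
    gcongr
  have hlog : ‖lg z + (Real.log r : ℂ)‖ ≤ B + |Real.log r| := by
    refine (norm_add_le _ _).trans ?_
    rw [Complex.norm_real, Real.norm_eq_abs]
    gcongr
  calc ‖z ^ 2 * green2 lg r z‖
      = ‖z‖ ^ 2 * (‖-(4 * Complex.I)⁻¹‖ * ‖hankelH0 (z * r) (lg z + (Real.log r : ℂ))‖) := by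
        rw [green2, norm_mul, norm_mul, norm_pow]
    _ ≤ A ^ 2 * (‖-(4 * Complex.I)⁻¹‖ * (M * (1 + (B + |Real.log r|)))) := by
        gcongr
        exact (hH _ _ hzr).trans (by gcongr)
    _ = A ^ 2 * (‖-(4 * Complex.I)⁻¹‖ * M) * (1 + B + |Real.log r|) := by ring

theorem exists_isHolomorphicKernelOn_green2 (hE : Module.finrank ℝ E = 2) {lg : ℂ → ℂ} {ω : ℂ}
    (hlg : AnalyticAt ℂ lg ω) : ∃ U ∈ 𝓝 ω, IsHolomorphicKernelOn E (green2 lg) U := by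
  have hball : Metric.ball 0 (‖ω‖ + 1) ∈ 𝓝 ω := Metric.isOpen_ball.mem_nhds (by simp)
  refine ⟨_, inter_mem (inter_mem hlg.eventually_analyticAt
    (hlg.continuousAt.norm.eventually_lt_const (lt_add_one ‖lg ω‖))) hball,
    isHolomorphicKernelOn_of_radial_bound (measurable_green2 lg) (fun r _ z hz => ?_)
    fun D => ?_⟩
  · exact ((differentiableAt_id.pow 2).mul
      (differentiableAt_green2 hz.1.1.differentiableAt r)).differentiableWithinAt
  · obtain ⟨M, hM⟩ := exists_norm_sq_mul_green2_le (A := ‖ω‖ + 1) (B := ‖lg ω‖ + 1) D (lg := lg)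
    refine ⟨fun r => M * (r * (1 + (‖lg ω‖ + 1)) + |r * Real.log r|), ?_, fun r hr hrD z hz => ?_⟩
    · have := Real.continuous_mul_log
      fun_prop
    · rw [hE]
      beta_reduce
      rw [pow_one, abs_mul, abs_of_pos hr]
      calc r * ‖z ^ 2 * green2 lg r z‖
          ≤ r * (M * (1 + (‖lg ω‖ + 1) + |Real.log r|)) := by
            gcongr
            exact hM r hr hrD z hz.2 hz.1.2.le
        _ = M * (r * (1 + (‖lg ω‖ + 1)) + r * |Real.log r|) := by ring

theorem exists_isHolomorphicKernelOn_outgoingGreen {d : ℕ} (hd : d = 1 ∨ d = 2 ∨ d = 3)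
    {lg : ℂ → ℂ} {ω : ℂ} (hlg : AnalyticAt ℂ lg ω) :
    ∃ U ∈ 𝓝 ω, IsHolomorphicKernelOn (EuclideanSpace ℝ (Fin d)) (outgoingGreen lg d) U := by
  have hball : Metric.ball 0 (‖ω‖ + 1) ∈ 𝓝 ω := Metric.isOpen_ball.mem_nhds (by simp)
  rcases hd with rfl | rfl | rfl
  · exact ⟨_, hball, isHolomorphicKernelOn_green1 _⟩
  · exact exists_isHolomorphicKernelOn_green2 (by simp) hlg
  · exact ⟨_, hball, isHolomorphicKernelOn_green3 (by simp) _⟩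

end GreenFunctions

section Primitives

/-- `F` is an indefinite integral of the locally integrable function `ψ`, that is, `F` is locally
absolutely continuous with `F' = ψ` almost everywhere. -/
structure IsPrimitiveOf {E : Type*} [NormedAddCommGroup E] [NormedSpace ℝ E] (F ψ : ℝ → E) :
    Prop where
  intervalIntegrable (a b : ℝ) : IntervalIntegrable ψ volume a b
  integral_eq_sub (a b : ℝ) : ∫ x in a..b, ψ x = F b - F a

namespace IsPrimitiveOf

section NormedSpace

variable {E : Type*} [NormedAddCommGroup E] [NormedSpace ℝ E] {F G ψ η : ℝ → E}

theorem of_intervalIntegrable (hψ : ∀ a b, IntervalIntegrable ψ volume a b) (a : ℝ) :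
    IsPrimitiveOf (fun x => ∫ t in a..x, ψ t) ψ :=
  ⟨hψ, fun b c => (intervalIntegral.integral_interval_sub_left (hψ a c) (hψ a b)).symm⟩

theorem eq_add_integral (h : IsPrimitiveOf F ψ) (a x : ℝ) : F x = F a + ∫ t in a..x, ψ t := by
  rw [h.integral_eq_sub, add_sub_cancel]

theorem congr (h : IsPrimitiveOf F ψ) (hF : ∀ x, G x = F x) (hψ : ∀ x, η x = ψ x) :
    IsPrimitiveOf G η := by
  rwa [funext hF, funext hψ]

theorem add (hF : IsPrimitiveOf F ψ) (hG : IsPrimitiveOf G η) :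
    IsPrimitiveOf (fun x => F x + G x) (fun x => ψ x + η x) where
  intervalIntegrable a b := (hF.intervalIntegrable a b).add (hG.intervalIntegrable a b)
  integral_eq_sub a b := by
    rw [intervalIntegral.integral_add (hF.intervalIntegrable a b) (hG.intervalIntegrable a b),
      hF.integral_eq_sub, hG.integral_eq_sub]
    abel

theorem continuous (h : IsPrimitiveOf F ψ) : Continuous F := by
  rw [funext (h.eq_add_integral 0)]
  exact continuous_const.add (intervalIntegral.continuous_primitive h.intervalIntegrable 0)

variable [CompleteSpace E]

theorem of_hasDerivAt (h : ∀ x, HasDerivAt F (ψ x) x) (hψ : Continuous ψ) : IsPrimitiveOf F ψ where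
  intervalIntegrable a b := hψ.intervalIntegrable a b
  integral_eq_sub a b :=
    intervalIntegral.integral_eq_sub_of_hasDerivAt (fun x _ => h x) (hψ.intervalIntegrable a b)

theorem hasDerivAt (h : IsPrimitiveOf F ψ) (hψ : Continuous ψ) (x : ℝ) :
    HasDerivAt F (ψ x) x := by
  rw [funext (h.eq_add_integral 0)]
  exact (intervalIntegral.integral_hasDerivAt_right (h.intervalIntegrable 0 x)
    (hψ.stronglyMeasurableAtFilter _ _) hψ.continuousAt).const_add _

theorem clm_comp {E' : Type*} [NormedAddCommGroup E'] [NormedSpace ℝ E'] [CompleteSpace E']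
    (hF : IsPrimitiveOf F ψ) (A : E →L[ℝ] E') :
    IsPrimitiveOf (fun x => A (F x)) (fun x => A (ψ x)) where
  intervalIntegrable a b := ⟨A.integrable_comp (hF.intervalIntegrable a b).1,
    A.integrable_comp (hF.intervalIntegrable a b).2⟩
  integral_eq_sub a b := by
    rw [A.intervalIntegral_comp_comm (hF.intervalIntegrable a b), hF.integral_eq_sub, map_sub]

end NormedSpace

section Real

variable {F G ψ η : ℝ → ℝ}

theorem absolutelyContinuousOnInterval (hF : IsPrimitiveOf F ψ) (a b : ℝ) :
    AbsolutelyContinuousOnInterval F a b := by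
  rw [funext (hF.eq_add_integral a)]
  exact ((LipschitzWith.const (F a)).lipschitzOnWith.absolutelyContinuousOnInterval).add
    ((hF.intervalIntegrable a b).absolutelyContinuousOnInterval_intervalIntegral
      Set.left_mem_uIcc)

theorem ae_deriv_eq (hF : IsPrimitiveOf F ψ) (a b : ℝ) :
    ∀ᵐ x, x ∈ Set.uIoc a b → deriv F x = ψ x := by
  filter_upwards [(hF.intervalIntegrable a b).ae_hasDerivAt_integral] with x hx hxab
  have := (hx (Set.uIoc_subset_uIcc hxab) a Set.left_mem_uIcc).const_add (F a)
  rw [← funext (hF.eq_add_integral a)] at this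
  exact this.deriv

theorem mul_real (hF : IsPrimitiveOf F ψ) (hG : IsPrimitiveOf G η) :
    IsPrimitiveOf (fun x => F x * G x) (fun x => ψ x * G x + F x * η x) where
  intervalIntegrable a b :=
    ((hF.intervalIntegrable a b).mul_continuousOn hG.continuous.continuousOn).add
      ((hG.intervalIntegrable a b).continuousOn_mul hF.continuous.continuousOn)
  integral_eq_sub a b := by
    rw [← (hF.absolutelyContinuousOnInterval a b).integral_deriv_mul_eq_sub
      (hG.absolutelyContinuousOnInterval a b)]
    refine intervalIntegral.integral_congr_ae ?_
    filter_upwards [hF.ae_deriv_eq a b, hG.ae_deriv_eq a b] with x hFx hGx hx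
    rw [hFx hx, hGx hx]

end Real

section Complex

variable {F G ψ η : ℝ → ℂ}

theorem mul (hF : IsPrimitiveOf F ψ) (hG : IsPrimitiveOf G η) :
    IsPrimitiveOf (fun x => F x * G x) (fun x => ψ x * G x + F x * η x) := by
  have hFr := hF.clm_comp Complex.reCLM
  have hFi := hF.clm_comp Complex.imCLM
  have hGr := hG.clm_comp Complex.reCLM
  have hGi := hG.clm_comp Complex.imCLM
  have hre := (hFr.mul_real hGr).add ((hFi.mul_real hGi).clm_comp (-.id ℝ ℝ))
  have him := (hFr.mul_real hGi).add (hFi.mul_real hGr)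
  refine ((hre.clm_comp Complex.ofRealCLM).add
    ((him.clm_comp Complex.ofRealCLM).clm_comp
      (ContinuousLinearMap.mul ℝ ℂ Complex.I))).congr (fun x => ?_) (fun x => ?_) <;>
    apply Complex.ext <;> simp <;> ring

theorem const_mul (hF : IsPrimitiveOf F ψ) (c : ℂ) :
    IsPrimitiveOf (fun x => c * F x) (fun x => c * ψ x) :=
  hF.clm_comp (ContinuousLinearMap.mul ℝ ℂ c)

theorem sub (hF : IsPrimitiveOf F ψ) (hG : IsPrimitiveOf G η) :
    IsPrimitiveOf (fun x => F x - G x) (fun x => ψ x - η x) :=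
  (hF.add (hG.const_mul (-1))).congr (fun x => by ring) fun x => by ring

end Complex

end IsPrimitiveOf

theorem isPrimitiveOf_ofReal : IsPrimitiveOf (fun x : ℝ => (x : ℂ)) fun _ => 1 :=
  .of_hasDerivAt (fun _ => Complex.ofRealCLM.hasDerivAt) continuous_const

theorem isPrimitiveOf_exp_const_mul (c : ℂ) :
    IsPrimitiveOf (fun x : ℝ => Complex.exp (c * x)) fun x => c * Complex.exp (c * x) := by
  refine .of_hasDerivAt (fun x => ?_) (by fun_prop)
  have h := (Complex.ofRealCLM.hasDerivAt (x := x)).const_mul c |>.cexp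
  simpa [mul_comm c] using h

end Primitives

section Interval

/-- The solution of `v' = c v + h`, `v(a) = 0`. -/
noncomputable def duhamel (c : ℂ) (a : ℝ) (h : ℝ → ℂ) (x : ℝ) : ℂ :=
  ∫ y in a..x, Complex.exp (c * (x - y)) * h y

/-- The derivative of `duhamel c a h` in `c`: the solution of `w' = c w + duhamel c a h`,
`w(a) = 0`. -/
noncomputable def duhamelDeriv (c : ℂ) (a : ℝ) (h : ℝ → ℂ) (x : ℝ) : ℂ :=
  ∫ y in a..x, (x - y) * Complex.exp (c * (x - y)) * h y

theorem duhamel_self (c : ℂ) (a : ℝ) (h : ℝ → ℂ) : duhamel c a h a = 0 :=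
  intervalIntegral.integral_same

theorem duhamelDeriv_self (c : ℂ) (a : ℝ) (h : ℝ → ℂ) : duhamelDeriv c a h a = 0 :=
  intervalIntegral.integral_same

theorem duhamel_eq (c : ℂ) (a : ℝ) (h : ℝ → ℂ) (x : ℝ) :
    duhamel c a h x = Complex.exp (c * x) * ∫ y in a..x, Complex.exp (-c * y) * h y := by
  rw [duhamel, ← intervalIntegral.integral_const_mul]
  refine intervalIntegral.integral_congr fun y _ => ?_
  rw [mul_sub, sub_eq_add_neg, Complex.exp_add, neg_mul, mul_assoc]

theorem duhamelDeriv_eq {h : ℝ → ℂ} (hh : ∀ a b, IntervalIntegrable h volume a b) (c : ℂ) (a : ℝ)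
    (x : ℝ) : duhamelDeriv c a h x = x * duhamel c a h x -
      Complex.exp (c * x) * ∫ y in a..x, y * (Complex.exp (-c * y) * h y) := by
  have hint : IntervalIntegrable (fun y : ℝ => Complex.exp (-c * y) * h y) volume a x :=
    (hh a x).continuousOn_mul (by fun_prop)
  rw [duhamel_eq, mul_left_comm, ← mul_sub, ← intervalIntegral.integral_const_mul,
    ← intervalIntegral.integral_sub (hint.const_mul _) (hint.continuousOn_mul (by fun_prop)),
    ← intervalIntegral.integral_const_mul, duhamelDeriv]
  refine intervalIntegral.integral_congr fun y _ => ?_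
  rw [mul_sub c, sub_eq_add_neg (c * _), Complex.exp_add, neg_mul]
  ring

theorem isPrimitiveOf_duhamel {h : ℝ → ℂ} (hh : ∀ a b, IntervalIntegrable h volume a b) (c : ℂ)
    (a : ℝ) : IsPrimitiveOf (duhamel c a h) fun x => c * duhamel c a h x + h x := by
  have hP : IsPrimitiveOf (fun x => ∫ y in a..x, Complex.exp (-c * y) * h y) _ :=
    .of_intervalIntegrable (fun b b' => (hh b b').continuousOn_mul (by fun_prop)) a
  refine ((isPrimitiveOf_exp_const_mul c).mul hP).congr (duhamel_eq c a h) fun x => ?_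
  rw [duhamel_eq, ← mul_assoc, ← mul_assoc, ← Complex.exp_add, neg_mul, add_neg_cancel,
    Complex.exp_zero, one_mul]

theorem isPrimitiveOf_duhamelDeriv {h : ℝ → ℂ} (hh : ∀ a b, IntervalIntegrable h volume a b)
    (c : ℂ) (a : ℝ) :
    IsPrimitiveOf (duhamelDeriv c a h) fun x => c * duhamelDeriv c a h x + duhamel c a h x := by
  have hP : IsPrimitiveOf (fun x => ∫ y in a..x, y * (Complex.exp (-c * y) * h y)) _ :=
    .of_intervalIntegrable (fun b b' => ((hh b b').continuousOn_mul (by fun_prop)).continuousOn_mul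
      (by fun_prop)) a
  refine ((isPrimitiveOf_ofReal.mul (isPrimitiveOf_duhamel hh c a)).sub
    ((isPrimitiveOf_exp_const_mul c).mul hP)).congr (duhamelDeriv_eq hh c a) fun x => ?_
  have hexp : Complex.exp (c * x) * Complex.exp (-c * x) = 1 := by
    rw [← Complex.exp_add, neg_mul, add_neg_cancel, Complex.exp_zero]
  rw [duhamelDeriv_eq hh]
  linear_combination (x * h x) * hexp

theorem integral_Icc_kernel_norm_sub {K g : ℝ → ℂ} {L : ℝ} (hL : 0 ≤ L) (hK : Continuous K)
    (hg : IntegrableOn g (Set.Ioc 0 L)) (x : ℝ) :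
    ∫ y in Set.Icc 0 L, K ‖x - y‖ * g y =
      (∫ y in 0..x, K (x - y) * (Set.Ioc 0 L).indicator g y) -
        ∫ y in L..x, K (y - x) * (Set.Ioc 0 L).indicator g y := by
  set h := (Set.Ioc 0 L).indicator g
  have hzero (y : ℝ) (hy : y ∉ Set.Ioc 0 L) : h y = 0 := Set.indicator_of_notMem hy g
  have hint (a b : ℝ) : IntervalIntegrable (fun y => K ‖x - y‖ * h y) volume a b :=
    ((integrable_indicator_iff measurableSet_Ioc).mpr hg).intervalIntegrable.continuousOn_mul
      (by fun_prop)
  calc ∫ y in Set.Icc 0 L, K ‖x - y‖ * g y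
      = ∫ y in 0..L, K ‖x - y‖ * h y := by
        rw [integral_Icc_eq_integral_Ioc, intervalIntegral.integral_of_le hL]
        exact setIntegral_congr_fun measurableSet_Ioc fun y hy =>
          congrArg _ (Set.indicator_of_mem hy g).symm
    _ = (∫ y in 0..x, K ‖x - y‖ * h y) - ∫ y in L..x, K ‖x - y‖ * h y := by
        rw [← intervalIntegral.integral_add_adjacent_intervals (hint 0 x) (hint x L),
          intervalIntegral.integral_symm L x, sub_eq_add_neg]
    _ = _ := by
        congr 1 <;> refine intervalIntegral.integral_congr_ae (ae_of_all _ fun y hy => ?_)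
        · rcases Set.mem_uIoc.mp hy with hy | hy
          · rw [Real.norm_of_nonneg (sub_nonneg.mpr hy.2)]
          · rw [hzero y fun hy0 => hy.2.not_gt hy0.1, mul_zero, mul_zero]
        · rcases Set.mem_uIoc.mp hy with hy | hy
          · rw [hzero y fun hyL => hy.1.not_ge hyL.2, mul_zero, mul_zero]
          · rw [Real.norm_of_nonpos (sub_nonpos.mpr hy.1.le), neg_sub]

theorem kernelAt_green1 {E : Type*} [NormedAddCommGroup E] (z : ℂ) (x : E) :
    kernelAt green1 z x = Complex.I / 2 * z * Complex.exp (Complex.I * z * ‖x‖) := by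
  rw [kernelAt, sq_mul_green1, mul_inv, Complex.inv_I]
  ring

theorem kernelDerivAt_green1 {E : Type*} [NormedAddCommGroup E] (ω : ℂ) (x : E) :
    kernelDerivAt green1 ω x =
      Complex.I / 2 * (1 + Complex.I * ω * ‖x‖) * Complex.exp (Complex.I * ω * ‖x‖) := by
  simp only [kernelDerivAt, kernelAt_green1]
  refine (((hasDerivAt_id ω).const_mul (Complex.I / 2)).mul
    (((hasDerivAt_id ω).const_mul Complex.I).mul_const (‖x‖ : ℂ)).cexp).deriv.trans ?_
  simp only [id]
  ring

/-- `u` solves the Helmholtz equation `u'' + ω² u = s` on the line with the boundary conditions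
`u' = ±(i ω u + b)` at `L` and at `0`, and `p = u'`. For `b = 0` this is the outgoing condition on
`[0, L]`; its derivative in `ω` has `b = i u`. -/
structure IsOutgoingSolution (L : ℝ) (ω : ℂ) (s b u p : ℝ → ℂ) : Prop where
  isPrimitiveOf : IsPrimitiveOf u p
  isPrimitiveOf_deriv : IsPrimitiveOf p fun x => s x - ω ^ 2 * u x
  right : p L = Complex.I * ω * u L + b L
  left : p 0 = -(Complex.I * ω * u 0 + b 0)

variable {L : ℝ} {ω : ℂ} {s t b c u p f q : ℝ → ℂ}

theorem IsOutgoingSolution.integral_lagrange (hu : IsOutgoingSolution L ω s b u p)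
    (hf : IsOutgoingSolution L ω t c f q) :
    ∫ x in 0..L, (u x * t x - f x * s x) =
      (u L * c L + u 0 * c 0) - (f L * b L + f 0 * b 0) := by
  have h := ((hu.isPrimitiveOf.mul hf.isPrimitiveOf_deriv).sub
    (hf.isPrimitiveOf.mul hu.isPrimitiveOf_deriv)).integral_eq_sub 0 L
  rw [hu.right, hu.left, hf.right, hf.left] at h
  convert h using 1
  · exact intervalIntegral.integral_congr fun x _ => by ring
  · ring

theorem IsOutgoingSolution.integral_energy (hu : IsOutgoingSolution L ω s b u p) :
    ∫ x in 0..L, (p x ^ 2 + (s x - ω ^ 2 * u x) * u x) =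
      Complex.I * ω * (u 0 ^ 2 + u L ^ 2) + (u L * b L + u 0 * b 0) := by
  have h := (hu.isPrimitiveOf.mul hu.isPrimitiveOf_deriv).integral_eq_sub 0 L
  rw [hu.right, hu.left] at h
  convert h using 1
  · exact intervalIntegral.integral_congr fun x _ => by ring
  · ring

theorem isOutgoingSolution_duhamel {h : ℝ → ℂ} (hh : ∀ a b, IntervalIntegrable h volume a b)
    (L : ℝ) (ω : ℂ) (hu : ∀ x, u x = Complex.I / 2 * ω *
      (duhamel (Complex.I * ω) 0 h x - duhamel (-(Complex.I * ω)) L h x)) :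
    IsOutgoingSolution L ω (fun x => -ω ^ 2 * h x) 0 u fun x => Complex.I / 2 * ω *
      (Complex.I * ω * (duhamel (Complex.I * ω) 0 h x + duhamel (-(Complex.I * ω)) L h x)) where
  isPrimitiveOf := (((isPrimitiveOf_duhamel hh _ 0).sub
    (isPrimitiveOf_duhamel hh _ L)).const_mul _).congr hu fun x => by ring
  isPrimitiveOf_deriv := ((((isPrimitiveOf_duhamel hh _ 0).add
    (isPrimitiveOf_duhamel hh _ L)).const_mul _).const_mul _).congr (fun _ => rfl) fun x => by
      linear_combination (-ω ^ 2 * (h x + u x)) * Complex.I_sq + (Complex.I * ω) ^ 2 * hu x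
  right := by
    rw [hu, duhamel_self, Pi.zero_apply]
    ring
  left := by
    rw [hu, duhamel_self, Pi.zero_apply]
    ring

theorem isOutgoingSolution_duhamelDeriv {h : ℝ → ℂ}
    (hh : ∀ a b, IntervalIntegrable h volume a b) (L : ℝ) (ω : ℂ)
    (hu : ∀ x, u x = Complex.I / 2 * ω *
      (duhamel (Complex.I * ω) 0 h x - duhamel (-(Complex.I * ω)) L h x))
    (hf : ∀ x, f x = Complex.I / 2 *
      (duhamel (Complex.I * ω) 0 h x - duhamel (-(Complex.I * ω)) L h x +
        Complex.I * ω *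
          (duhamelDeriv (Complex.I * ω) 0 h x + duhamelDeriv (-(Complex.I * ω)) L h x))) :
    IsOutgoingSolution L ω (fun x => -2 * ω * (u x + h x)) (fun x => Complex.I * u x) f
      fun x => Complex.I / 2 * (Complex.I * ω *
        (2 * (duhamel (Complex.I * ω) 0 h x + duhamel (-(Complex.I * ω)) L h x) +
          Complex.I * ω *
            (duhamelDeriv (Complex.I * ω) 0 h x - duhamelDeriv (-(Complex.I * ω)) L h x))) := by
  have hv₀ := isPrimitiveOf_duhamel hh (Complex.I * ω) 0
  have hvL := isPrimitiveOf_duhamel hh (-(Complex.I * ω)) L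
  have hw₀ := isPrimitiveOf_duhamelDeriv hh (Complex.I * ω) 0
  have hwL := isPrimitiveOf_duhamelDeriv hh (-(Complex.I * ω)) L
  refine ⟨?_, ?_, ?_, ?_⟩
  · exact (((hv₀.sub hvL).add ((hw₀.add hwL).const_mul _)).const_mul _).congr hf fun x => by ring
  · refine (((((hv₀.add hvL).const_mul 2).add ((hw₀.sub hwL).const_mul _)).const_mul _).const_mul
      _).congr (fun _ => rfl) fun x => ?_
    linear_combination (-2 * ω * (u x + h x) - ω ^ 2 * f x) * Complex.I_sq +
      (Complex.I * ω) ^ 2 * hf x + 2 * Complex.I ^ 2 * ω * hu x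
  · rw [hu, hf, duhamel_self, duhamelDeriv_self]
    ring
  · rw [hu, hf, duhamel_self, duhamelDeriv_self]
    ring

theorem convOn_kernelAt_green1 {g : ℝ → ℂ} (hL : 0 ≤ L) (hg : IntegrableOn g (Set.Ioc 0 L))
    (x : ℝ) : convOn (Set.Icc 0 L) (kernelAt green1 ω) g x = Complex.I / 2 * ω *
      (duhamel (Complex.I * ω) 0 ((Set.Ioc 0 L).indicator g) x -
        duhamel (-(Complex.I * ω)) L ((Set.Ioc 0 L).indicator g) x) := by
  simp only [convOn, kernelAt_green1]
  rw [integral_Icc_kernel_norm_sub (K := fun r => Complex.I / 2 * ω *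
    Complex.exp (Complex.I * ω * r)) hL (by fun_prop) hg, mul_sub, duhamel, duhamel,
    ← intervalIntegral.integral_const_mul, ← intervalIntegral.integral_const_mul]
  congr 1 <;> refine intervalIntegral.integral_congr fun y _ => ?_
  · push_cast
    ring
  · rw [← neg_sub x y, Complex.ofReal_neg, mul_neg, ← neg_mul, Complex.ofReal_sub, mul_assoc]

theorem integral_one_add_mul_exp_mul {h : ℝ → ℂ} (hh : ∀ a b, IntervalIntegrable h volume a b)
    (c : ℂ) (a x : ℝ) :
    ∫ y in a..x, (1 + c * (x - y)) * Complex.exp (c * (x - y)) * h y =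
      duhamel c a h x + c * duhamelDeriv c a h x := by
  rw [duhamel, duhamelDeriv, ← intervalIntegral.integral_const_mul,
    ← intervalIntegral.integral_add ((hh a x).continuousOn_mul (by fun_prop))
      (((hh a x).continuousOn_mul (by fun_prop)).const_mul c)]
  exact intervalIntegral.integral_congr fun y _ => by ring

theorem convOn_kernelDerivAt_green1 {g : ℝ → ℂ} (hL : 0 ≤ L) (hg : IntegrableOn g (Set.Ioc 0 L))
    (x : ℝ) : convOn (Set.Icc 0 L) (kernelDerivAt green1 ω) g x = Complex.I / 2 *
      (duhamel (Complex.I * ω) 0 ((Set.Ioc 0 L).indicator g) x -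
        duhamel (-(Complex.I * ω)) L ((Set.Ioc 0 L).indicator g) x +
        Complex.I * ω * (duhamelDeriv (Complex.I * ω) 0 ((Set.Ioc 0 L).indicator g) x +
          duhamelDeriv (-(Complex.I * ω)) L ((Set.Ioc 0 L).indicator g) x)) := by
  have hh (a b : ℝ) : IntervalIntegrable ((Set.Ioc 0 L).indicator g) volume a b :=
    ((integrable_indicator_iff measurableSet_Ioc).mpr hg).intervalIntegrable
  simp only [convOn, kernelDerivAt_green1]
  rw [integral_Icc_kernel_norm_sub (K := fun r => Complex.I / 2 * (1 + Complex.I * ω * r) *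
    Complex.exp (Complex.I * ω * r)) hL (by fun_prop) hg]
  calc _ = Complex.I / 2 * (∫ y in 0..x, (1 + Complex.I * ω * (x - y)) *
          Complex.exp (Complex.I * ω * (x - y)) * (Set.Ioc 0 L).indicator g y) -
        Complex.I / 2 * ∫ y in L..x, (1 + -(Complex.I * ω) * (x - y)) *
          Complex.exp (-(Complex.I * ω) * (x - y)) * (Set.Ioc 0 L).indicator g y := by
        rw [← intervalIntegral.integral_const_mul, ← intervalIntegral.integral_const_mul]
        congr 1 <;> refine intervalIntegral.integral_congr fun y _ => ?_
        · push_cast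
          ring
        · rw [← neg_sub x y, Complex.ofReal_neg, mul_neg, ← neg_mul, Complex.ofReal_sub, mul_assoc,
            mul_assoc, mul_assoc]
    _ = _ := by
        rw [integral_one_add_mul_exp_mul hh, integral_one_add_mul_exp_mul hh]
        ring

theorem IsOutgoingSolution.sq_mul_integral_eq {h : ℝ → ℂ}
    (hh : ∀ a b, IntervalIntegrable h volume a b)
    (hu : IsOutgoingSolution L ω (fun x => -ω ^ 2 * h x) 0 u p)
    (hf : IsOutgoingSolution L ω (fun x => -2 * ω * (u x + h x)) (fun x => Complex.I * u x) f q) :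
    ω ^ 2 * ∫ x in 0..L, h x * f x =
      2 * ω * (∫ x in 0..L, (u x + h x) * u x) + Complex.I * (u 0 ^ 2 + u L ^ 2) := by
  have hcu := hu.isPrimitiveOf.continuous
  have hcf := hf.isPrimitiveOf.continuous
  have hl := hu.integral_lagrange hf
  have hsplit : ∫ x in 0..L, (u x * (-2 * ω * (u x + h x)) - f x * (-ω ^ 2 * h x)) =
      ω ^ 2 * (∫ x in 0..L, h x * f x) - 2 * ω * ∫ x in 0..L, (u x + h x) * u x := by
    rw [← intervalIntegral.integral_const_mul, ← intervalIntegral.integral_const_mul,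
      ← intervalIntegral.integral_sub
        (((hh 0 L).mul_continuousOn hcf.continuousOn).const_mul _)
        ((((hcu.intervalIntegrable 0 L).add (hh 0 L)).mul_continuousOn
          hcu.continuousOn).const_mul _)]
    exact intervalIntegral.integral_congr fun x _ => by ring
  rw [hsplit] at hl
  simp only [Pi.zero_apply] at hl
  linear_combination hl

theorem IsOutgoingSolution.integral_sq_deriv_add_eq {h : ℝ → ℂ}
    (hh : ∀ a b, IntervalIntegrable h volume a b)
    (hu : IsOutgoingSolution L ω (fun x => -ω ^ 2 * h x) 0 u p) :
    ∫ x in 0..L, (p x ^ 2 + ω ^ 2 * ((u x + h x) * u x)) =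
      ω * (2 * ω * (∫ x in 0..L, (u x + h x) * u x) + Complex.I * (u 0 ^ 2 + u L ^ 2)) := by
  have hcu := hu.isPrimitiveOf.continuous
  have hcp := hu.isPrimitiveOf_deriv.continuous
  have hint := (((hcu.intervalIntegrable 0 L).add (hh 0 L)).mul_continuousOn
    hcu.continuousOn).const_mul (2 * ω ^ 2)
  have hp : IntervalIntegrable
      (fun x => p x ^ 2 + (-ω ^ 2 * h x - ω ^ 2 * u x) * u x) volume 0 L :=
    ((hcp.pow 2).intervalIntegrable 0 L).add ((hu.isPrimitiveOf_deriv.intervalIntegrable 0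
      L).mul_continuousOn hcu.continuousOn)
  calc ∫ x in 0..L, (p x ^ 2 + ω ^ 2 * ((u x + h x) * u x))
      = ∫ x in 0..L, ((p x ^ 2 + (-ω ^ 2 * h x - ω ^ 2 * u x) * u x) +
          2 * ω ^ 2 * ((u x + h x) * u x)) :=
        intervalIntegral.integral_congr fun x _ => by ring
    _ = Complex.I * ω * (u 0 ^ 2 + u L ^ 2) +
          2 * ω ^ 2 * ∫ x in 0..L, (u x + h x) * u x := by
        rw [intervalIntegral.integral_add hp hint, intervalIntegral.integral_const_mul,
          hu.integral_energy]
        simp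
    _ = _ := by ring

theorem IsResonancePair.exists_isOutgoingSolution {n : ℝ → ℝ} (hL : 0 ≤ L)
    (hn : MemLp (contrast n) ∞ (volume.restrict (Set.Icc 0 L)))
    (hu : IsResonancePair green1 (Set.Icc 0 L) n ω u) :
    ∃ p q h : ℝ → ℂ, (∀ x ∈ Set.Ioc 0 L, h x = contrast n x * u x) ∧
      (∀ a b, IntervalIntegrable h volume a b) ∧
      IsOutgoingSolution L ω (fun x => -ω ^ 2 * h x) 0 u p ∧
      IsOutgoingSolution L ω (fun x => -2 * ω * (u x + h x)) (fun x => Complex.I * u x)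
        (fun x => deriv (fun z => scatteringOp green1 (Set.Icc 0 L) n z u x) ω) q := by
  have hK : IsHolomorphicKernelOn ℝ green1 (Metric.ball 0 (‖ω‖ + 1)) :=
    isHolomorphicKernelOn_green1 _
  have hU : Metric.ball 0 (‖ω‖ + 1) ∈ 𝓝 ω := Metric.isOpen_ball.mem_nhds (by simp)
  have hΩ := Metric.isBounded_Icc (0 : ℝ) L
  have hg := hu.memLp_contrast_mul hK (mem_of_mem_nhds hU) measurableSet_Icc hΩ hn
  have hgi : IntegrableOn (fun x => contrast n x * u x) (Set.Ioc 0 L) :=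
    IntegrableOn.mono_set (hg.integrable le_top) Set.Ioc_subset_Icc_self
  have hh (a b : ℝ) : IntervalIntegrable
      ((Set.Ioc 0 L).indicator fun x => contrast n x * u x) volume a b :=
    ((integrable_indicator_iff measurableSet_Ioc).mpr hgi).intervalIntegrable
  have hu_eq (x : ℝ) := (hu.2.2 x).trans <| (congrFun scatteringOp_eq_convOn x).trans <|
    convOn_kernelAt_green1 hL hgi x
  have hf_eq (x : ℝ) := (hK.deriv_scatteringOp hU measurableSet_Icc hΩ hg x).trans <|
    convOn_kernelDerivAt_green1 hL hgi x
  exact ⟨_, _, _, fun x hx => Set.indicator_of_mem hx _, hh,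
    isOutgoingSolution_duhamel hh L ω hu_eq, isOutgoingSolution_duhamelDeriv hh L ω hu_eq hf_eq⟩

theorem IsResonancePair.contDiff_and_modeNormalization_eq {n : ℝ → ℝ} (hL : 0 ≤ L)
    (hn : MemLp (contrast n) ∞ (volume.restrict (Set.Icc 0 L)))
    (hu : IsResonancePair green1 (Set.Icc 0 L) n ω u) :
    ContDiff ℝ 1 u ∧
      modeNormalization green1 (Set.Icc 0 L) n ω u =
        2 * ω * (∫ x in 0..L, (n x : ℂ) ^ 2 * u x ^ 2) + Complex.I * (u 0 ^ 2 + u L ^ 2) ∧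
      modeNormalization green1 (Set.Icc 0 L) n ω u =
        ω⁻¹ * ∫ x in 0..L, (deriv u x ^ 2 + ω ^ 2 * (n x : ℂ) ^ 2 * u x ^ 2) := by
  obtain ⟨p, q, h, hh_eq, hh, hup, hfq⟩ := hu.exists_isOutgoingSolution hL hn
  have hd := hup.isPrimitiveOf.hasDerivAt hup.isPrimitiveOf_deriv.continuous
  have hp : deriv u = p := funext fun x => (hd x).deriv
  have hadd (x : ℝ) (hx : x ∈ Set.uIoc 0 L) :
      (u x + h x) * u x = (n x : ℂ) ^ 2 * u x ^ 2 := by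
    rw [hh_eq x (Set.uIoc_of_le hL ▸ hx), contrast]
    ring
  have hM : modeNormalization green1 (Set.Icc 0 L) n ω u =
      2 * ω * (∫ x in 0..L, (u x + h x) * u x) + Complex.I * (u 0 ^ 2 + u L ^ 2) := by
    rw [← hup.sq_mul_integral_eq hh hfq, modeNormalization, integral_Icc_eq_integral_Ioc,
      intervalIntegral.integral_of_le hL]
    congr 1
    exact setIntegral_congr_fun measurableSet_Ioc fun x hx => by rw [hh_eq x hx]
  refine ⟨contDiff_one_iff_deriv.mpr ⟨fun x => (hd x).differentiableAt,
    hp ▸ hup.isPrimitiveOf_deriv.continuous⟩, ?_, ?_⟩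
  · rw [hM, intervalIntegral.integral_congr_ae (ae_of_all _ hadd)]
  · rw [hM, eq_inv_mul_iff_mul_eq₀ hu.omega_ne_zero, ← hup.integral_sq_deriv_add_eq hh, hp]
    exact intervalIntegral.integral_congr_ae (ae_of_all _ fun x hx => by
      rw [hadd x hx, mul_assoc])

end Interval

end ScatteringResonance

open ScatteringResonance in
theorem proposition4p1_general (nm np : ℝ) :
    (∀ (d : ℕ), d = 1 ∨ d = 2 ∨ d = 3 →
      ∀ (Ω : Set (EuclideanSpace ℝ (Fin d))), MeasurableSet Ω → Bornology.IsBounded Ω →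
      ∀ (lg : ℂ → ℂ) (n : EuclideanSpace ℝ (Fin d) → ℝ) (ω : ℂ)
        (u : EuclideanSpace ℝ (Fin d) → ℂ),
        IsLogDeterminationAt lg ω → n ∈ Admissible Ω nm np →
        IsResonancePair (outgoingGreen lg d) Ω n ω u →
        IsNondegenerate (outgoingGreen lg d) Ω n ω u →
        ∃ W : (EuclideanSpace ℝ (Fin d) → ℝ) → ℂ,
          IsResonanceMapAt (outgoingGreen lg d) Ω nm np n ω W ∧
          ∃ α : ℂ, α ≠ 0 ∧
            HasFirstVariationAt Ω nm np W n (gradOmega α ω n u)) ∧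
    (∀ (L : ℝ), 0 ≤ L → ∀ (n : ℝ → ℝ) (ω : ℂ) (u : ℝ → ℂ),
        n ∈ Admissible (Set.Icc 0 L) nm np →
        IsResonancePair green1 (Set.Icc 0 L) n ω u →
        IsNondegenerate green1 (Set.Icc 0 L) n ω u →
        ContDiff ℝ 1 u ∧
        ∃ W : (ℝ → ℝ) → ℂ,
          IsResonanceMapAt green1 (Set.Icc 0 L) nm np n ω W ∧
          ∃ α : ℂ, α ≠ 0 ∧
            α⁻¹ = 2 * ω * (∫ x in (0 : ℝ)..L, (n x : ℂ) ^ 2 * u x ^ 2)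
              + Complex.I * (u 0 ^ 2 + u L ^ 2) ∧
            α⁻¹ = ω⁻¹ * ∫ x in (0 : ℝ)..L, (deriv u x ^ 2 + ω ^ 2 * (n x : ℂ) ^ 2 * u x ^ 2) ∧
            HasFirstVariationAt (Set.Icc 0 L) nm np W n (gradOmega α ω n u)) := by
  refine ⟨fun d hd Ω hΩm hΩ lg n ω u hlg hn hu hnd => ?_, fun L hL n ω u hn hu hnd => ?_⟩
  · obtain ⟨U, hU, hK⟩ := exists_isHolomorphicKernelOn_outgoingGreen hd hlg.1
    obtain ⟨W, hW, hV⟩ := exists_isResonanceMapAt_and_hasFirstVariationAt hK hU hΩm hΩ hn hu hnd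
    have hα := hnd.modeNormalization_ne_zero hu hK hU hΩm hΩ (Admissible.memLp_contrast hn hΩm)
    exact ⟨W, hW, _, inv_ne_zero hα, hV⟩
  · have hK := isHolomorphicKernelOn_green1 (E := ℝ) (‖ω‖ + 1)
    have hU : Metric.ball 0 (‖ω‖ + 1) ∈ 𝓝 ω := Metric.isOpen_ball.mem_nhds (by simp)
    have hΩ := Metric.isBounded_Icc (0 : ℝ) L
    have hnL := Admissible.memLp_contrast hn measurableSet_Icc
    obtain ⟨W, hW, hV⟩ :=
      exists_isResonanceMapAt_and_hasFirstVariationAt hK hU measurableSet_Icc hΩ hn hu hnd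
    have hα := hnd.modeNormalization_ne_zero hu hK hU measurableSet_Icc hΩ hnL
    obtain ⟨hC, hα_eq, hα_eq'⟩ := hu.contDiff_and_modeNormalization_eq hL hnL
    exact ⟨hC, W, hW, _, inv_ne_zero hα, (inv_inv _).trans hα_eq, (inv_inv _).trans hα_eq', hV⟩

theorem proposition4p1 (nm np : ℝ) (hnm : 0 < nm) (hnp : nm < np) :
    -- dimensions one, two and three
    (∀ (d : ℕ), d = 1 ∨ d = 2 ∨ d = 3 →
      ∀ (Ω : Set (EuclideanSpace ℝ (Fin d))), IsOpen Ω → Bornology.IsBounded Ω →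
      ∀ (lg : ℂ → ℂ) (n : EuclideanSpace ℝ (Fin d) → ℝ) (ω : ℂ)
        (u : EuclideanSpace ℝ (Fin d) → ℂ),
        ScatteringResonance.IsLogDeterminationAt lg ω →
        n ∈ ScatteringResonance.Admissible Ω nm np →
        ScatteringResonance.IsResonancePair (ScatteringResonance.outgoingGreen lg d) Ω n ω u →
        ScatteringResonance.IsNondegenerate (ScatteringResonance.outgoingGreen lg d) Ω n ω u →
        ∃ W : (EuclideanSpace ℝ (Fin d) → ℝ) → ℂ,
          ScatteringResonance.IsResonanceMapAt (ScatteringResonance.outgoingGreen lg d)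
            Ω nm np n ω W ∧
          ∃ α : ℂ, α ≠ 0 ∧
            ScatteringResonance.HasFirstVariationAt Ω nm np W n
              (ScatteringResonance.gradOmega α ω n u)) ∧
    -- dimension one, with the interval `[0, L]`
    (∀ (L : ℝ), 0 < L → ∀ (n : ℝ → ℝ) (ω : ℂ) (u : ℝ → ℂ),
        n ∈ ScatteringResonance.Admissible (Set.Icc 0 L) nm np →
        ScatteringResonance.IsResonancePair ScatteringResonance.green1 (Set.Icc 0 L) n ω u →
        ScatteringResonance.IsNondegenerate ScatteringResonance.green1 (Set.Icc 0 L) n ω u →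
        ContDiff ℝ 1 u ∧
        ∃ W : (ℝ → ℝ) → ℂ,
          ScatteringResonance.IsResonanceMapAt ScatteringResonance.green1
            (Set.Icc 0 L) nm np n ω W ∧
          ∃ α : ℂ, α ≠ 0 ∧
            α⁻¹ = 2 * ω * (∫ x in (0 : ℝ)..L, (n x : ℂ) ^ 2 * u x ^ 2)
              + Complex.I * (u 0 ^ 2 + u L ^ 2) ∧
            α⁻¹ = ω⁻¹ * ∫ x in (0 : ℝ)..L, (deriv u x ^ 2 + ω ^ 2 * (n x : ℂ) ^ 2 * u x ^ 2) ∧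
            ScatteringResonance.HasFirstVariationAt (Set.Icc 0 L) nm np W n
              (ScatteringResonance.gradOmega α ω n u)) := by
  have h := proposition4p1_general nm np
  exact ⟨fun d hd Ω hΩ => h.1 d hd Ω hΩ.measurableSet, fun L hL => h.2 L hL.le⟩
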